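/- Let $K$ be an algebraically closed field and let $G$ be a linear algebraic group over $K$ acting (algebraically) on irreducible affine varieties $X$ and $Y$ over $K$. Let $H \subset G$ be a subgroup whose normaliser $N \subset G$ is finite, of order coprime to $\operatorname{char} K$ (no condition on the order if $\operatorname{char} K = 0$). Write $X^H$ and $Y^H$ for the sets of points fixed by $H$; they are closed subvarieties on which $N/H$ acts. Let $A \subset X^H$ be an irreducible (locally closed) subvariety that is stable under $N/H$, and let $U \subset A$ be a dense open subset such that (i) the morphism $G \times U \to X$, $(g,\phi) \mapsto g\phi$, has dense image; (ii) the stabiliser in $G$ of each element of $U$ is $H$; (iii) either $\operatorname{char} K = 0$, or the derivative of the morphism in (i), as a linear map of Zariski tangent spaces, is an isomorphism at every point of $G \times U$. Then every $G$-equivariant rational map $F : X \dashrightarrow Y$ is defined on a dense open subset of $A$, its restriction to $A$ is an $N/H$-equivariant rational map $f : A \dashrightarrow Y^H$, and $F \mapsto f = F|_A$ is a bijection between - $G$-equivariant rational maps $F : X \dashrightarrow Y$, and - $N/H$-equivariant rational maps $f : A \dashrightarrow Y^H$. -/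

import Mathlib

open Topology MulAction

section Varieties

universe u v w

/-- A `K`-algebra of `K`-valued functions on a set `X`, playing the role of the coordinate ring.
For an affine variety this is the ring of regular functions; for a subset of an affine variety it
is the ring of restrictions of regular functions of the ambient variety. -/
class CoordinateRing (K : Type u) [Field K] (X : Type v) where
  /-- The algebra of functions. -/
  functions : Subalgebra K (X → K)

/-- The coordinate ring `K[X]`. -/
abbrev coordRing (K : Type u) [Field K] (X : Type v) [CoordinateRing K X] :
    Subalgebra K (X → K) :=
  CoordinateRing.functions

/-- On a subset: restrictions of the functions on the ambient set. -/
instance CoordinateRing.subtype (K : Type u) [Field K] (X : Type v) [CoordinateRing K X]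
    (p : X → Prop) : CoordinateRing K (Subtype p) where
  functions := (coordRing K X).map
    (AlgHom.pi fun x : Subtype p => Pi.evalAlgHom K (fun _ : X => K) x.1)

/-- On a product: the algebra generated by the functions on the two factors
(that is, the image of `K[X] ⊗ K[Y]`). -/
instance CoordinateRing.prod (K : Type u) [Field K] (X : Type v) (Y : Type w)
    [CoordinateRing K X] [CoordinateRing K Y] : CoordinateRing K (X × Y) where
  functions := Algebra.adjoin K
    ({f | ∃ a ∈ coordRing K X, f = fun z => a z.1} ∪ {f | ∃ b ∈ coordRing K Y, f = fun z => b z.2})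

/-- Evaluation of the functions in the coordinate ring at a point. -/
def evalAt (K : Type u) [Field K] {X : Type v} [CoordinateRing K X] (x : X) :
    coordRing K X →ₐ[K] K :=
  (Pi.evalAlgHom K (fun _ : X => K) x).comp (coordRing K X).val

/-- `X` with its coordinate ring is an affine variety (possibly reducible) over the algebraically
closed field `K`: the ring is a finitely generated algebra of functions, and the points of `X` are
the `K`-algebra homomorphisms `K[X] → K`. Equivalently, a choice of generators identifies `X` with
a Zariski closed subset of `Kⁿ` and `K[X]` with the polynomial functions on it. -/
structure IsAffineVariety (K : Type u) [Field K] (X : Type v) [CoordinateRing K X] : Prop where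
  fg : (coordRing K X).FG
  bijective_evalAt : Function.Bijective (evalAt K : X → (coordRing K X →ₐ[K] K))

/-- The Zariski topology, with basis the sets where a function in the coordinate ring does not
vanish. On a subset it is the topology induced from the ambient variety. -/
@[reducible] def zariskiTopology (K : Type u) [Field K] (X : Type v) [CoordinateRing K X] :
    TopologicalSpace X :=
  TopologicalSpace.generateFrom {V | ∃ f ∈ coordRing K X, V = {x | f x ≠ 0}}

/-- Irreducible (in particular non-empty) in the Zariski topology. -/
def IsIrreducibleVariety (K : Type u) [Field K] (X : Type v) [CoordinateRing K X] : Prop :=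
  @IrreducibleSpace X (zariskiTopology K X)

/-- Zariski open and dense. -/
structure IsDenseOpen (K : Type u) [Field K] {X : Type v} [CoordinateRing K X]
    (V : Set X) : Prop where
  isOpen : IsOpen[zariskiTopology K X] V
  dense : @Dense X (zariskiTopology K X) V

/-- A map that pulls the coordinate ring back into the coordinate ring. Between affine varieties
these are exactly the morphisms. -/
def IsPolynomialMap (K : Type u) [Field K] {X : Type v} {Y : Type w}
    [CoordinateRing K X] [CoordinateRing K Y] (φ : X → Y) : Prop :=
  ∀ f ∈ coordRing K Y, f ∘ φ ∈ coordRing K X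

/-- A regular function on a (locally closed) subset `X` of an affine variety: locally it is a
quotient of functions in the coordinate ring. -/
def IsRegularFunction (K : Type u) [Field K] {X : Type v} [CoordinateRing K X]
    (f : X → K) : Prop :=
  ∀ x, ∃ p ∈ coordRing K X, ∃ q ∈ coordRing K X, q x ≠ 0 ∧ ∀ y, q y ≠ 0 → f y = p y / q y

/-- A morphism from a (locally closed) subset of an affine variety to a subset of an affine
variety. -/
def IsMorphism (K : Type u) [Field K] {X : Type v} {Y : Type w}
    [CoordinateRing K X] [CoordinateRing K Y] (φ : X → Y) : Prop :=
  ∀ f ∈ coordRing K Y, IsRegularFunction K (f ∘ φ)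

/-! ### Rational maps -/

/-- A morphism to `Y` defined on a dense open subset of `X`. -/
structure RatRep (K : Type u) [Field K] (X : Type v) (Y : Type w)
    [CoordinateRing K X] [CoordinateRing K Y] where
  domain : Set X
  isDenseOpen : IsDenseOpen K domain
  toFun : domain → Y
  isMorphism : IsMorphism K toFun

/-- Two such morphisms are equivalent if they agree on a dense open subset of `X`. -/
instance RatRep.setoid (K : Type u) [Field K] (X : Type v) (Y : Type w)
    [CoordinateRing K X] [CoordinateRing K Y] : Setoid (RatRep K X Y) where
  r φ ψ := ∃ V : Set X, IsDenseOpen K V ∧ ∀ x ∈ V, ∃ (h₁ : x ∈ φ.domain) (h₂ : x ∈ ψ.domain),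
    φ.toFun ⟨x, h₁⟩ = ψ.toFun ⟨x, h₂⟩
  iseqv :=
    { refl := fun φ => ⟨φ.domain, φ.isDenseOpen, fun _ hx => ⟨hx, hx, rfl⟩⟩
      symm := fun ⟨V, hV, h⟩ => ⟨V, hV, fun x hx =>
        let ⟨h₁, h₂, e⟩ := h x hx
        ⟨h₂, h₁, e.symm⟩⟩
      trans := fun ⟨V, hV, h⟩ ⟨W, hW, h'⟩ => by
        let := zariskiTopology K X
        refine ⟨V ∩ W, ⟨hV.isOpen.inter hW.isOpen,
          hV.dense.inter_of_isOpen_left hW.dense hV.isOpen⟩, fun x hx => ?_⟩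
        obtain ⟨h₁, h₂, e⟩ := h x hx.1
        obtain ⟨h₃, h₄, e'⟩ := h' x hx.2
        exact ⟨h₁, h₄, e.trans e'⟩ }

/-- Rational maps `X ⇢ Y`. -/
def RatMap (K : Type u) [Field K] (X : Type v) (Y : Type w)
    [CoordinateRing K X] [CoordinateRing K Y] : Type (max v w) :=
  Quotient (RatRep.setoid K X Y)

/-- A rational map `F : X ⇢ Y` is `Q`-equivariant if `F (q x) = q F(x)` wherever both sides are
defined. -/
def RatMap.IsEquivariant {K : Type u} [Field K] {X : Type v} {Y : Type w}
    [CoordinateRing K X] [CoordinateRing K Y] (Q : Type*) [Group Q] [MulAction Q X] [MulAction Q Y]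
    (F : RatMap K X Y) : Prop :=
  ∃ φ : RatRep K X Y, Quotient.mk _ φ = F ∧
    ∀ (q : Q) (x : X) (h : x ∈ φ.domain) (h' : q • x ∈ φ.domain),
      φ.toFun ⟨q • x, h'⟩ = q • φ.toFun ⟨x, h⟩

/-- Let `i : A → X` and `j : B → Y` be inclusions. The rational map `f : A ⇢ B` is the restriction
of `F : X ⇢ Y`: on some dense open subset of `A`, both are defined and agree. -/
def RatMap.IsRestriction {K : Type u} [Field K] {X Y A B : Type*} [CoordinateRing K X]
    [CoordinateRing K Y] [CoordinateRing K A] [CoordinateRing K B] (i : A → X) (j : B → Y)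
    (F : RatMap K X Y) (f : RatMap K A B) : Prop :=
  ∃ (Φ : RatRep K X Y) (φ : RatRep K A B), Quotient.mk _ Φ = F ∧ Quotient.mk _ φ = f ∧
    ∀ (a : A) (h : a ∈ φ.domain), ∃ h' : i a ∈ Φ.domain, Φ.toFun ⟨i a, h'⟩ = j (φ.toFun ⟨a, h⟩)

/-! ### Tangent spaces -/

/-- The Zariski tangent space at `x`: point derivations of the coordinate ring at `x`. -/
def tangentSpace (K : Type u) [Field K] {X : Type v} [CoordinateRing K X] (x : X) :
    Submodule K (Module.Dual K (coordRing K X)) where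
  carrier := {D | ∀ f g, D (f * g) = f.1 x * D g + g.1 x * D f}
  add_mem' := fun hD hE f g => by
    simp only [LinearMap.add_apply, hD f g, hE f g]; ring
  zero_mem' := fun f g => by simp
  smul_mem' := fun c D hD f g => by
    simp only [LinearMap.smul_apply, hD f g, smul_eq_mul]; ring

/-- The homomorphism of coordinate rings `f ↦ f ∘ φ`. -/
def comorphism {K : Type u} [Field K] {X : Type v} {Y : Type w} [CoordinateRing K X]
    [CoordinateRing K Y] {φ : X → Y} (hφ : IsPolynomialMap K φ) :
    coordRing K Y →ₗ[K] coordRing K X where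
  toFun f := ⟨f.1 ∘ φ, hφ f.1 f.2⟩
  map_add' _ _ := rfl
  map_smul' _ _ := rfl

/-- The derivative `T_x X → T_{φ(x)} Y`, `D ↦ (f ↦ D (f ∘ φ))`. -/
def derivativeAt {K : Type u} [Field K] {X : Type v} {Y : Type w} [CoordinateRing K X]
    [CoordinateRing K Y] {φ : X → Y} (hφ : IsPolynomialMap K φ) (x : X) :
    tangentSpace K x →ₗ[K] tangentSpace K (φ x) :=
  (comorphism hφ).dualMap.restrict fun _ hD f g => hD (comorphism hφ f) (comorphism hφ g)

end Varieties

section Groups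

universe u v w

/-- `G` is a linear algebraic group: an affine variety whose group operations are morphisms. -/
structure IsLinearAlgebraicGroup (K : Type u) [Field K] (G : Type v) [Group G]
    [CoordinateRing K G] : Prop where
  isAffineVariety : IsAffineVariety K G
  mul : IsPolynomialMap K (fun p : G × G => p.1 * p.2)
  inv : IsPolynomialMap K (fun g : G => g⁻¹)

/-- The action of `G` on `X` is algebraic: `G × X → X` is a morphism. -/
def IsAlgebraicAction (K : Type u) [Field K] (G : Type v) [Group G] [CoordinateRing K G]
    (X : Type w) [CoordinateRing K X] [MulAction G X] : Prop :=
  IsPolynomialMap K (fun p : G × X => p.1 • p.2)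

theorem isPolynomialMap_subtype_val (K : Type u) [Field K] (X : Type v) [CoordinateRing K X]
    (p : X → Prop) : IsPolynomialMap K (Subtype.val : Subtype p → X) :=
  fun f hf => ⟨f, hf, rfl⟩

theorem IsPolynomialMap.comp {K : Type u} [Field K] {X Y Z : Type*} [CoordinateRing K X]
    [CoordinateRing K Y] [CoordinateRing K Z] {ψ : Y → Z} {φ : X → Y}
    (hψ : IsPolynomialMap K ψ) (hφ : IsPolynomialMap K φ) : IsPolynomialMap K (ψ ∘ φ) :=
  fun f hf => hφ _ (hψ f hf)

theorem IsAlgebraicAction.isPolynomialMap {K : Type u} [Field K] {G X S : Type*} [Group G]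
    [CoordinateRing K G] [CoordinateRing K X] [CoordinateRing K S] [MulAction G X]
    (h : IsAlgebraicAction K G X) {i : S → X} (hi : IsPolynomialMap K i) :
    IsPolynomialMap K (fun p : G × S => p.1 • i p.2) := by
  have h₂ : IsPolynomialMap K (fun p : G × S => (p.1, i p.2)) := by
    intro f hf
    induction hf using Algebra.adjoin_induction with
    | mem f hf =>
      rcases hf with ⟨a, ha, rfl⟩ | ⟨b, hb, rfl⟩
      · exact Algebra.subset_adjoin (Or.inl ⟨a, ha, rfl⟩)
      · exact Algebra.subset_adjoin (Or.inr ⟨b ∘ i, hi b hb, rfl⟩)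
    | algebraMap r => exact (coordRing K (G × S)).algebraMap_mem r
    | add f g _ _ hf hg => exact (coordRing K (G × S)).add_mem hf hg
    | mul f g _ _ hf hg => exact (coordRing K (G × S)).mul_mem hf hg
  exact IsPolynomialMap.comp h h₂

/-- `N/H`, where `N` is the normaliser of `H` in `G`. -/
abbrev NormalizerQuotient {G : Type v} [Group G] (H : Subgroup G) : Type v :=
  Subgroup.normalizer (H : Set G) ⧸ H.subgroupOf (Subgroup.normalizer (H : Set G))

/-- The normaliser of `H` acts on the fixed points of `H`. -/
instance normalizerAction {G : Type v} [Group G] (H : Subgroup G) (X : Type w) [MulAction G X] :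
    MulAction (Subgroup.normalizer (H : Set G)) (fixedPoints H X) where
  smul n x := ⟨(n : G) • (x : X), fun h => by
    have hn := (Subgroup.mem_normalizer_iff''.1 n.2 (h : G)).1 h.2
    have hx : ((n : G)⁻¹ * h * n) • (x : X) = x := x.2 ⟨_, hn⟩
    calc (h : G) • (n : G) • (x : X) = (n : G) • ((n : G)⁻¹ * h * n) • (x : X) := by
          simp [← mul_smul, mul_assoc]
      _ = (n : G) • (x : X) := by rw [hx]⟩
  one_smul x := Subtype.ext (one_smul G (x : X))
  mul_smul m n x := Subtype.ext (mul_smul (m : G) (n : G) (x : X))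

/-- The induced action of `N/H` on the fixed points of `H`: the class of `n` sends `x` to `n x`. -/
instance normalizerQuotientAction {G : Type v} [Group G] (H : Subgroup G) (X : Type w)
    [MulAction G X] : MulAction (NormalizerQuotient H) (fixedPoints H X) where
  smul q x := Quotient.liftOn' q (fun n => n • x) fun m n hmn => by
    have h : ((m : G)⁻¹ * n) ∈ H := by
      simpa [Subgroup.mem_subgroupOf] using QuotientGroup.leftRel_apply.1 hmn
    have hx : ((m : G)⁻¹ * n) • (x : X) = x := x.2 ⟨_, h⟩
    refine Subtype.ext (?_ : (m : G) • (x : X) = (n : G) • (x : X))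
    rw [mul_smul, inv_smul_eq_iff] at hx
    exact hx.symm
  one_smul x := one_smul (Subgroup.normalizer (H : Set G)) x
  mul_smul p q x := by
    induction p using QuotientGroup.induction_on with | H m => ?_
    induction q using QuotientGroup.induction_on with | H n => ?_
    exact mul_smul m n x

/-- The map `G × U → X`, `(g, a) ↦ g a`, for a subset `U` of a subset `A` of the fixed points. -/
def orbitMap {G : Type v} [Group G] {H : Subgroup G} {X : Type w} [MulAction G X]
    {A : SubMulAction (NormalizerQuotient H) (fixedPoints H X)} (U : Set A) (p : G × U) : X :=
  p.1 • ((p.2 : A) : fixedPoints H X).1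

theorem isPolynomialMap_orbitMap {K : Type u} [Field K] {G : Type v} [Group G]
    [CoordinateRing K G] {H : Subgroup G} {X : Type w} [CoordinateRing K X] [MulAction G X]
    (h : IsAlgebraicAction K G X)
    {A : SubMulAction (NormalizerQuotient H) (fixedPoints H X)} (U : Set A) :
    IsPolynomialMap K (orbitMap U) :=
  h.isPolynomialMap (((isPolynomialMap_subtype_val K X _).comp
    (isPolynomialMap_subtype_val K _ _)).comp (isPolynomialMap_subtype_val K _ _))

end Groups

/-! Equivariance forces the correspondence: `F` is determined on the orbits through `A` by `F (g a)
= g f(a)`. These orbits are dense in `X`, even when `a` runs only over a dense open subset of `A`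
(`exists_smul_mem_of_isOpen`). Hence `f` determines `F` (`RatMap.IsRestriction.injective`). Since an
equivariant rational map equals all its translates, its domain can be moved by a group element until
it meets `A`; the values there are fixed by `H` because the points are (`exists_isRestriction`).

For surjectivity, put `ψ(g, a) = g f(a)`. If `g a = g' a'` with `a, a'` in `U`, then `g'⁻¹ g`
conjugates one stabiliser to the other; both are `H`, so it lies in `N`, and `N/H`-equivariance of
`f` shows that `ψ` is constant on the fibres of `(g, a) ↦ g a` (`smul_toFun_eq_smul_toFun`). It
remains to see that the resulting map on `X` is rational, which is where separability enters.

That descent is algebra (`exists_mul_eq_of_isDomain`). Let `B ⊂ S` be domains with fraction fields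
`L ⊂ M`, and let `h ∈ S` be constant on fibres. Then `h ⊗ 1 - 1 ⊗ h` vanishes at every point of the
fibre product, so it is nilpotent in `S ⊗[B] S`, hence in `M ⊗[L] M`. In characteristic zero this
already makes `h` algebraic over `L`, hence separable; otherwise injectivity of the derivative gives
vanishing of the relative differentials, so `M/L` is separable. For separable `h` the ring `L(h)
⊗[L] L(h)` is reduced, so `h ⊗ 1 = 1 ⊗ h` and `h ∈ L`. Chevalley's theorem
(`exists_ne_zero_forall_exists_algHom_comp_eq`) supplies an open set over which the fibres are
nonempty, so that the quotient defines a map there (`exists_factorization`). -/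

section CommutativeAlgebra

/-! ### Nullstellensatz, Chevalley's theorem and descent of functions constant on fibres. -/

open TensorProduct

/-- A nontrivial algebra of finite type over an algebraically closed field has a rational point. -/
theorem nonempty_algHom_of_finiteType (K : Type*) [Field K] [IsAlgClosed K] (S : Type*) [CommRing S]
    [Algebra K S] [Algebra.FiniteType K S] [Nontrivial S] : Nonempty (S →ₐ[K] K) := by
  obtain ⟨m, hm⟩ := Ideal.exists_maximal S
  let := Ideal.Quotient.field m
  have := finite_of_finite_type_of_isJacobsonRing K (S ⧸ m)
  exact ⟨(IsAlgClosed.lift (R := K) (S := S ⧸ m) (M := K)).comp (Ideal.Quotient.mkₐ K m)⟩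

/-- An element killed by all rational points is nilpotent. -/
theorem isNilpotent_of_forall_algHom_eq_zero (K : Type*) [Field K] [IsAlgClosed K] {S : Type*}
    [CommRing S] [Algebra K S] [Algebra.FiniteType K S] {s : S}
    (hs : ∀ χ : S →ₐ[K] K, χ s = 0) : IsNilpotent s := by
  by_contra h
  -- If `s` is not nilpotent, inverting it leaves a nonzero ring; a rational point of that ring is a
  -- point of `S` at which `s` does not vanish.
  have : Nontrivial (Localization.Away s) :=
    not_subsingleton_iff_nontrivial.1 fun h' => h <|
      (IsLocalization.subsingleton_iff (M := Submonoid.powers s)).1 h'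
  have : Algebra.FiniteType S (Localization.Away s) :=
    IsLocalization.finiteType_of_monoid_fg (Submonoid.powers s) _
  have : Algebra.FiniteType K (Localization.Away s) := .trans ‹_› this
  obtain ⟨χ⟩ := nonempty_algHom_of_finiteType K (Localization.Away s)
  have h₁ := (IsLocalization.Away.algebraMap_isUnit (S := Localization.Away s) s).map χ
  exact h₁.ne_zero (hs (χ.comp (IsScalarTower.toAlgHom K S _)))

/-- A constructible set containing a generic point contains a neighbourhood of it. -/
theorem exists_isOpen_subset_of_isConstructible {T : Type*} [TopologicalSpace T] {η : T}
    (hη : Dense ({η} : Set T)) {s : Set T} (hs : IsConstructible s) :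
    ∃ V, IsOpen V ∧ η ∈ V ∧ (η ∈ s → V ⊆ s) ∧ (η ∉ s → V ⊆ sᶜ) := by
  -- Treating `η ∈ s` and `η ∉ s` together makes the claim symmetric under complements, so the
  -- induction closes.
  induction hs using IsConstructible.empty_union_induction with
  | open_retrocompact U hU _ =>
    by_cases h : η ∈ U
    · exact ⟨U, hU, h, fun _ => subset_rfl, fun h' => absurd h h'⟩
    -- The generic point lies in every nonempty open set, so here `U` is empty.
    · refine ⟨Set.univ, isOpen_univ, trivial, fun h' => absurd h' h, fun _ x _ hx => h ?_⟩
      obtain ⟨y, hy, rfl⟩ := hη.inter_open_nonempty U hU ⟨x, hx⟩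
      exact hy
  | union s _ t _ hs ht =>
    obtain ⟨V, hV, hηV, h₁, h₂⟩ := hs
    obtain ⟨W, hW, hηW, h₃, h₄⟩ := ht
    refine ⟨V ∩ W, hV.inter hW, ⟨hηV, hηW⟩, ?_, ?_⟩
    · rintro (h | h) x hx
      · exact Or.inl (h₁ h hx.1)
      · exact Or.inr (h₃ h hx.2)
    · rintro h x hx (h' | h')
      · exact h₂ (fun h'' => h (Or.inl h'')) hx.1 h'
      · exact h₄ (fun h'' => h (Or.inr h'')) hx.2 h'
  | compl s _ hs =>
    obtain ⟨V, hV, hηV, h₁, h₂⟩ := hs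
    exact ⟨V, hV, hηV, h₂, fun h => by simpa using h₁ (by simpa using h)⟩

/-- The morphism of varieties defined by an injective homomorphism of coordinate rings hits a
nonempty basic open set. -/
theorem exists_ne_zero_forall_exists_algHom_comp_eq (K : Type*) [Field K] [IsAlgClosed K]
    (B S : Type*) [CommRing B] [IsDomain B] [Algebra K B] [Algebra.FiniteType K B] [CommRing S]
    [Algebra K S] [Algebra.FiniteType K S] [Algebra B S] [IsScalarTower K B S]
    (hinj : Function.Injective (algebraMap B S)) :
    ∃ b : B, b ≠ 0 ∧ ∀ ψ : B →ₐ[K] K, ψ b ≠ 0 →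
      ∃ χ : S →ₐ[K] K, χ.comp (IsScalarTower.toAlgHom K B S) = ψ := by
  have hBN : IsNoetherianRing B := Algebra.FiniteType.isNoetherianRing K B
  have hBS : Algebra.FiniteType B S := .of_restrictScalars_finiteType K B S
  have hfp : (algebraMap B S).FinitePresentation :=
    RingHom.finitePresentation_algebraMap.mpr (Algebra.FinitePresentation.of_finiteType.mp hBS)
  let η : PrimeSpectrum B := ⟨⊥, Ideal.isPrime_bot⟩
  have hη : Dense ({η} : Set (PrimeSpectrum B)) := by
    rw [dense_iff_closure_eq, PrimeSpectrum.closure_singleton]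
    simp [η]
  have hηmem : η ∈ PrimeSpectrum.comap (algebraMap B S) '' Set.univ := by
    obtain ⟨P, hP, h⟩ := Ideal.exists_comap_eq_of_mem_minimalPrimes_of_injective hinj ⊥
      (by simp [IsDomain.minimalPrimes_eq_singleton_bot])
    exact ⟨⟨P, hP⟩, trivial, PrimeSpectrum.ext h⟩
  obtain ⟨V, hV, hηV, h, -⟩ := exists_isOpen_subset_of_isConstructible hη
    (PrimeSpectrum.isConstructible_comap_image hfp IsConstructible.univ)
  obtain ⟨_, ⟨b, rfl⟩, hb, hbV⟩ :=
    PrimeSpectrum.isTopologicalBasis_basic_opens.exists_subset_of_mem_open hηV hV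
  refine ⟨b, fun h0 => hb (by simp [h0]), fun ψ hψ => ?_⟩
  obtain ⟨P, -, hP⟩ := h hηmem (hbV (show (⟨RingHom.ker ψ, RingHom.ker_isPrime ψ⟩ :
    PrimeSpectrum B) ∈ PrimeSpectrum.basicOpen b from hψ))
  -- Any rational point of `S ⧸ P` lies over `ψ`: `x - ψ x` is in `ker ψ`, which is the contraction
  -- of `P`.
  obtain ⟨χ⟩ := nonempty_algHom_of_finiteType K (S ⧸ P.asIdeal)
  refine ⟨χ.comp (Ideal.Quotient.mkₐ K _), AlgHom.ext fun x => ?_⟩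
  have hx : x - algebraMap K B (ψ x) ∈ P.asIdeal.comap (algebraMap B S) := by
    rw [show P.asIdeal.comap (algebraMap B S) = RingHom.ker ψ from
      congrArg PrimeSpectrum.asIdeal hP]
    simp [RingHom.mem_ker]
  rw [Ideal.mem_comap, ← Ideal.Quotient.eq_zero_iff_mem] at hx
  have h' := congrArg χ hx
  rw [map_sub, map_sub, map_sub, map_zero, sub_eq_zero, ← IsScalarTower.algebraMap_apply K B S] at h'
  exact h'.trans ((χ.comp (Ideal.Quotient.mkₐ K P.asIdeal)).commutes _)

/-- If `(h ⊗ 1 - 1 ⊗ h) ^ n = 0` then `h ^ n` is a combination of smaller powers of `h`. -/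
theorem pow_mem_span_of_tmul_sub_tmul_pow_eq_zero {L M : Type*} [Field L] [Field M] [Algebra L M]
    {h : M} {n : ℕ} (hn : (h ⊗ₜ[L] (1 : M) - 1 ⊗ₜ h) ^ n = 0) :
    h ^ n ∈ Submodule.span L ((h ^ ·) '' Set.Iio n) := by
  by_contra hmem
  -- A functional `l` kills the lower powers but not `h ^ n`. Applying `l ⊗ id` to the binomial
  -- expansion leaves only the term `l (h ^ n) • 1`, which must then be zero.
  obtain ⟨l, hl, hl'⟩ := Submodule.exists_le_ker_of_notMem hmem
  have hl0 : ∀ k < n, l (h ^ k) = 0 := fun k hk =>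
    hl' (Submodule.subset_span ⟨k, hk, rfl⟩)
  have h₁ := congrArg (TensorProduct.lid L M ∘ LinearMap.rTensor M l) hn
  rw [sub_eq_add_neg, ← TensorProduct.tmul_neg, add_pow] at h₁
  simp only [Function.comp, map_sum, map_zero, Algebra.TensorProduct.tmul_pow, one_pow,
    Algebra.TensorProduct.tmul_mul_tmul, mul_one, one_mul, ← nsmul_eq_mul', map_nsmul,
    LinearMap.rTensor_tmul, TensorProduct.lid_tmul] at h₁
  rw [Finset.sum_range_succ, Finset.sum_eq_zero fun k hk => by
    rw [hl0 k (Finset.mem_range.1 hk), zero_smul, smul_zero]] at h₁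
  simp [hl] at h₁

/-- A separable element `h` with `h ⊗ 1 - 1 ⊗ h` nilpotent lies in the base field. -/
theorem mem_range_algebraMap_of_isNilpotent {L M : Type*} [Field L] [Field M] [Algebra L M]
    {h : M} (hsep : IsSeparable L h) (hn : IsNilpotent (h ⊗ₜ[L] (1 : M) - 1 ⊗ₜ h)) :
    h ∈ (algebraMap L M).range := by
  open IntermediateField in
  have : Algebra.IsSeparable L L⟮h⟯ :=
    (isSeparable_adjoin_simple_iff_isSeparable L M).2 hsep
  have : FiniteDimensional L L⟮h⟯ := adjoin.finiteDimensional hsep.isIntegral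
  have : Algebra.FormallyUnramified L L⟮h⟯ := .of_isSeparable _ _
  have : IsReduced (L⟮h⟯ ⊗[L] L⟮h⟯) :=
    Algebra.FormallyUnramified.isReduced_of_field L⟮h⟯ (L⟮h⟯ ⊗[L] L⟮h⟯)
  let g : L⟮h⟯ := AdjoinSimple.gen L h
  have hinj : Function.Injective (Algebra.TensorProduct.map L⟮h⟯.val L⟮h⟯.val) :=
    TensorProduct.map_injective_of_flat_flat _ _ L⟮h⟯.val.injective L⟮h⟯.val.injective
  have hg : IsNilpotent (g ⊗ₜ[L] (1 : L⟮h⟯) - 1 ⊗ₜ g) := by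
    rw [← IsNilpotent.map_iff hinj]
    simpa [g] using hn
  -- Reducedness turns nilpotent into zero, so exponent `1` is available; the span of the powers
  -- below `1` is then the base field.
  have h₁ := pow_mem_span_of_tmul_sub_tmul_pow_eq_zero (n := 1) (by rw [pow_one, hg.eq_zero])
  rw [pow_one, show Set.Iio 1 = {0} by ext; simp, Set.image_singleton, pow_zero,
    Submodule.mem_span_singleton] at h₁
  obtain ⟨c, hc⟩ := h₁
  refine ⟨c, ?_⟩
  have := congrArg L⟮h⟯.val hc
  simpa [g, Algebra.algebraMap_eq_smul_one] using this

/-- An algebra without relative point derivations is formally unramified. -/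
theorem formallyUnramified_of_pointDerivation_eq_zero (K : Type*) [Field K] [IsAlgClosed K]
    (B S : Type*) [CommRing B] [Algebra K B] [CommRing S]
    [Algebra K S] [Algebra.FiniteType K S] [Algebra B S] [IsScalarTower K B S]
    (hD : ∀ (χ : S →ₐ[K] K) (D : S →ₗ[K] K), (∀ s t, D (s * t) = χ s * D t + χ t * D s) →
      (∀ b, D (algebraMap B S b) = 0) → D = 0) :
    Algebra.FormallyUnramified B S := by
  have hBS : Algebra.FiniteType B S := .of_restrictScalars_finiteType K B S
  refine ⟨not_nontrivial_iff_subsingleton.1 fun hnt => ?_⟩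
  -- A nonzero finitely generated module of differentials has a simple quotient `S ⧸ m`, and `m` has
  -- residue field `K`. The universal derivation followed by this quotient is a point derivation
  -- killing `B`, hence zero; but the differentials span, which contradicts `N` being proper.
  obtain ⟨N, hN, -⟩ := (eq_top_or_exists_le_coatom (⊥ : Submodule S Ω[S⁄B])).resolve_left bot_ne_top
  have : IsSimpleModule S (Ω[S⁄B] ⧸ N) := isSimpleModule_iff_isCoatom.2 hN
  obtain ⟨m, hm, ⟨e⟩⟩ := isSimpleModule_iff_quot_maximal.1 this
  let := Ideal.Quotient.field m
  obtain ⟨χ⟩ := nonempty_algHom_of_finiteType K (S ⧸ m)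
  have hχ : ∀ (s : S) (q : S ⧸ m), χ (s • q) = χ (Ideal.Quotient.mk m s) * χ q := fun s q => by
    rw [← map_mul]; rfl
  let d : S →ₗ[K] Ω[S⁄B] := (KaehlerDifferential.D B S).toLinearMap.restrictScalars K
  let D : S →ₗ[K] K := χ.toLinearMap ∘ₗ (e.toLinearMap ∘ₗ N.mkQ).restrictScalars K ∘ₗ d
  have hD0 := hD (χ.comp (Ideal.Quotient.mkₐ K m)) D
    (fun s t => by simp [D, d, hχ]) (fun b => by simp [D, d])
  refine hN.1 (top_le_iff.1 ?_)
  rw [← KaehlerDifferential.span_range_derivation, Submodule.span_le]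
  rintro _ ⟨s, rfl⟩
  have hs : χ (e (N.mkQ (KaehlerDifferential.D B S s))) = 0 := LinearMap.congr_fun hD0 s
  rw [map_eq_zero_iff χ (RingHom.injective (χ : S ⧸ m →+* K)), map_eq_zero_iff e e.injective] at hs
  simpa using hs

/-- Transcendence transports the relation to polynomials, where the coefficient of `X ^ n` excludes
it. -/
theorem pow_notMem_span_of_transcendental {L M : Type*} [Field L] [Field M] [Algebra L M] {h : M}
    (hh : Transcendental L h) (n : ℕ) : h ^ n ∉ Submodule.span L ((h ^ ·) '' Set.Iio n) := by
  intro hmem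
  have himg : (h ^ ·) '' Set.Iio n =
      (Polynomial.aeval (R := L) h).toLinearMap '' ((Polynomial.X ^ ·) '' Set.Iio n) := by
    simp [Set.image_image]
  rw [himg, Submodule.span_image] at hmem
  obtain ⟨p, hp, hpn⟩ := hmem
  have hpX : p = Polynomial.X ^ n := transcendental_iff_injective.1 hh (by simpa using hpn)
  have hle : Submodule.span L ((Polynomial.X ^ ·) '' Set.Iio n) ≤
      LinearMap.ker (Polynomial.lcoeff L n) := by
    rw [Submodule.span_le]
    rintro _ ⟨k, hk, rfl⟩
    simp [Polynomial.coeff_X_pow, (Set.mem_Iio.1 hk).ne']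
  have := hle hp
  simp [hpX] at this

/-- A regular function that is constant on the fibres of a dominant, generically separable morphism
of irreducible affine varieties is a rational function on the target. -/
theorem exists_mul_eq_of_isDomain (K : Type*) [Field K] [IsAlgClosed K]
    (B S : Type*) [CommRing B] [IsDomain B] [Algebra K B] [CommRing S] [IsDomain S]
    [Algebra K S] [Algebra.FiniteType K S] [Algebra B S] [IsScalarTower K B S]
    (hinj : Function.Injective (algebraMap B S))
    (hsep : CharZero K ∨ Algebra.FormallyUnramified B S) (h : S)
    (hh : ∀ χ χ' : S →ₐ[K] K, (∀ b, χ (algebraMap B S b) = χ' (algebraMap B S b)) → χ h = χ' h) :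
    ∃ a b : B, a ≠ 0 ∧ algebraMap B S a * h = algebraMap B S b := by
  have hBS : Algebra.FiniteType B S := .of_restrictScalars_finiteType K B S
  have : FaithfulSMul B S := (faithfulSMul_iff_algebraMap_injective B S).2 hinj
  let L := FractionRing B
  let M := FractionRing S
  have : FaithfulSMul B M := (faithfulSMul_iff_algebraMap_injective B M).2 <| by
    rw [IsScalarTower.algebraMap_eq B S M]
    exact (IsFractionRing.injective S M).comp hinj
  let : Algebra L M := FractionRing.liftAlgebra B M
  have : IsScalarTower B L M := FractionRing.isScalarTower_liftAlgebra B M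
  have : Algebra.FiniteType K (S ⊗[B] S) := .trans ‹Algebra.FiniteType K S› inferInstance
  -- A rational point of `S ⊗[B] S` is a pair of points of `S` over the same point of `B`, and `h`
  -- takes equal values at the two.
  have hnil : IsNilpotent (h ⊗ₜ[B] (1 : S) - 1 ⊗ₜ h) := by
    refine isNilpotent_of_forall_algHom_eq_zero K fun χ => ?_
    rw [map_sub, sub_eq_zero]
    refine hh (χ.comp ((Algebra.TensorProduct.includeLeft : S →ₐ[B] S ⊗[B] S).restrictScalars K))
      (χ.comp ((Algebra.TensorProduct.includeRight : S →ₐ[B] S ⊗[B] S).restrictScalars K)) fun b => ?_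
    change χ (algebraMap B S b ⊗ₜ 1) = χ (1 ⊗ₜ algebraMap B S b)
    rw [Algebra.algebraMap_eq_smul_one, TensorProduct.smul_tmul]
  let τ : S ⊗[B] S →ₐ[B] M ⊗[L] M := Algebra.TensorProduct.productMap
    (((Algebra.TensorProduct.includeLeft : M →ₐ[L] M ⊗[L] M).restrictScalars B).comp
      (IsScalarTower.toAlgHom B S M))
    (((Algebra.TensorProduct.includeRight : M →ₐ[L] M ⊗[L] M).restrictScalars B).comp
      (IsScalarTower.toAlgHom B S M))
  have hnil' : IsNilpotent (algebraMap S M h ⊗ₜ[L] (1 : M) - 1 ⊗ₜ algebraMap S M h) := by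
    have := hnil.map τ
    rw [map_sub, Algebra.TensorProduct.productMap_apply_tmul,
      Algebra.TensorProduct.productMap_apply_tmul, map_one, map_one, mul_one, one_mul] at this
    exact this
  -- In characteristic zero only algebraicity is needed, and nilpotency rules out a transcendental
  -- `h`. Otherwise unramifiedness passes to the fraction fields, where it means separability.
  have hsep' : IsSeparable L (algebraMap S M h) := by
    rcases hsep with h0 | hu
    · have : CharZero B := charZero_of_injective_algebraMap (algebraMap K B).injective
      have : CharZero L := charZero_of_injective_algebraMap (IsFractionRing.injective B L)
      obtain ⟨n, hn⟩ := hnil'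
      suffices hint : IsAlgebraic L (algebraMap S M h) from
        (minpoly.irreducible hint.isIntegral).separable
      by_contra htr
      exact pow_notMem_span_of_transcendental htr n (pow_mem_span_of_tmul_sub_tmul_pow_eq_zero hn)
    · have : Algebra.FormallyUnramified S M := .of_isLocalization (nonZeroDivisors S)
      have : Algebra.FormallyUnramified B M := .comp B S M
      have : Algebra.FormallyUnramified L M := .of_restrictScalars B L M
      have : Algebra.EssFiniteType S M := .of_isLocalization _ (nonZeroDivisors S)
      have : Algebra.EssFiniteType B M := .comp B S M
      have : Algebra.EssFiniteType L M := .of_comp B L M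
      have := Algebra.FormallyUnramified.isSeparable L M
      exact Algebra.IsSeparable.isSeparable L _
  obtain ⟨x, hx⟩ := mem_range_algebraMap_of_isNilpotent hsep' hnil'
  obtain ⟨b, a, ha, rfl⟩ := IsFractionRing.div_surjective (A := B) x
  have ha0 : algebraMap B M a ≠ 0 := by
    simpa using nonZeroDivisors.ne_zero ha
  refine ⟨a, b, nonZeroDivisors.ne_zero ha, IsFractionRing.injective S M ?_⟩
  rw [map_mul, ← hx, map_div₀]
  simp only [← IsScalarTower.algebraMap_apply]
  rw [mul_div_cancel₀ _ ha0]

/-- A regular function that is constant on the fibres of a generically separable morphism is a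
rational function on the target, if the restriction of the morphism to some irreducible closed
subset is dominant. -/
theorem exists_ne_zero_forall_algHom_mul_eq_of_surjective (K : Type*) [Field K] [IsAlgClosed K]
    {B R S : Type*} [CommRing B] [IsDomain B] [Algebra K B] [Algebra.FiniteType K B] [CommRing R]
    [Algebra K R] [Algebra B R] [IsScalarTower K B R]
    [CommRing S] [IsDomain S] [Algebra K S] [Algebra.FiniteType K S] [Algebra B S]
    [IsScalarTower K B S] (hinj : Function.Injective (algebraMap B S))
    (π : R →ₐ[K] S) (hπ : Function.Surjective π)
    (hπB : ∀ b, π (algebraMap B R b) = algebraMap B S b)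
    (hsep : CharZero K ∨ ∀ (χ : R →ₐ[K] K) (D : R →ₗ[K] K),
      (∀ s t, D (s * t) = χ s * D t + χ t * D s) → (∀ b, D (algebraMap B R b) = 0) → D = 0) (h : R)
    (hh : ∀ χ χ' : R →ₐ[K] K, (∀ b, χ (algebraMap B R b) = χ' (algebraMap B R b)) → χ h = χ' h) :
    ∃ a b : B, a ≠ 0 ∧ (∀ ψ : B →ₐ[K] K, ψ a ≠ 0 →
      ∃ χ : R →ₐ[K] K, χ.comp (IsScalarTower.toAlgHom K B R) = ψ) ∧
      ∀ χ : R →ₐ[K] K, χ (algebraMap B R a) ≠ 0 →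
        χ (algebraMap B R a) * χ h = χ (algebraMap B R b) := by
  have hur : CharZero K ∨ Algebra.FormallyUnramified B S := by
    -- Point derivations of the quotient `S` pull back along `π` to point derivations of `R`, so the
    -- hypothesis on `R` is inherited by `S`.
    refine hsep.imp_right fun hD => formallyUnramified_of_pointDerivation_eq_zero K B S
      fun χ D hL hB => ?_
    have h0 := hD (χ.comp π) (D ∘ₗ π.toLinearMap) (fun s t => by simp [hL])
      (fun b => by simp [hπB, hB])
    ext s
    obtain ⟨s, rfl⟩ := hπ s
    exact LinearMap.congr_fun h0 s
  obtain ⟨a, b, ha, hab⟩ := exists_mul_eq_of_isDomain K B S hinj hur (π h) fun χ χ' hχ =>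
    hh (χ.comp π) (χ'.comp π) fun b => by simpa [hπB] using hχ b
  -- Where `e ≠ 0` every point of `B` lifts to `S`; multiplying numerator and denominator by `e`
  -- confines the formula to this locus.
  obtain ⟨e, he, hext⟩ := exists_ne_zero_forall_exists_algHom_comp_eq K B S hinj
  refine ⟨e * a, e * b, mul_ne_zero he ha, fun ψ hψ => ?_, fun χ hχ => ?_⟩
  · obtain ⟨χ, hχ⟩ := hext ψ (left_ne_zero_of_mul (by rwa [← map_mul]))
    refine ⟨χ.comp π, ?_⟩
    rw [← hχ]
    ext b
    simp [hπB]
  -- The point `χ` of `R` need not factor through `S`, but some point of `S` lies in the same fibre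
  -- and gives the same value of `h`.
  · obtain ⟨χ', hχ'⟩ := hext (χ.comp (IsScalarTower.toAlgHom K B R)) (by
      rw [map_mul, map_mul] at hχ
      exact left_ne_zero_of_mul hχ)
    have hB : ∀ b, χ' (algebraMap B S b) = χ (algebraMap B R b) := DFunLike.congr_fun hχ'
    have hχh : χ h = χ' (π h) := hh χ (χ'.comp π) fun b => by simp [hπB, hB]
    rw [hχh, ← hB, ← hB, ← map_mul, map_mul (algebraMap B S), map_mul (algebraMap B S), mul_assoc,
      hab]

/-- A regular function that is constant on the fibres of a dominant, generically separable morphism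
to an irreducible affine variety is a rational function on the target. -/
theorem exists_ne_zero_forall_algHom_mul_eq (K : Type*) [Field K] [IsAlgClosed K]
    {B R : Type*} [CommRing B] [IsDomain B] [Algebra K B] [Algebra.FiniteType K B] [CommRing R]
    [Algebra K R] [Algebra.FiniteType K R] [Algebra B R] [IsScalarTower K B R]
    (hinj : Function.Injective (algebraMap B R))
    (hsep : CharZero K ∨ ∀ (χ : R →ₐ[K] K) (D : R →ₗ[K] K),
      (∀ s t, D (s * t) = χ s * D t + χ t * D s) → (∀ b, D (algebraMap B R b) = 0) → D = 0) (h : R)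
    (hh : ∀ χ χ' : R →ₐ[K] K, (∀ b, χ (algebraMap B R b) = χ' (algebraMap B R b)) → χ h = χ' h) :
    ∃ a b : B, a ≠ 0 ∧ (∀ ψ : B →ₐ[K] K, ψ a ≠ 0 →
      ∃ χ : R →ₐ[K] K, χ.comp (IsScalarTower.toAlgHom K B R) = ψ) ∧
      ∀ χ : R →ₐ[K] K, χ (algebraMap B R a) ≠ 0 →
        χ (algebraMap B R a) * χ h = χ (algebraMap B R b) := by
  -- The source may be reducible; a prime over zero picks out an irreducible closed subset that
  -- still dominates the target.
  obtain ⟨P, hP, hPB⟩ := Ideal.exists_comap_eq_of_mem_minimalPrimes_of_injective hinj ⊥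
    (by simp [IsDomain.minimalPrimes_eq_singleton_bot])
  have hinj' : Function.Injective (algebraMap B (R ⧸ P)) := by
    rw [injective_iff_map_eq_zero]
    intro b hb
    rw [IsScalarTower.algebraMap_apply B R (R ⧸ P), Ideal.Quotient.algebraMap_eq,
      Ideal.Quotient.eq_zero_iff_mem, ← Ideal.mem_comap, hPB] at hb
    exact hb
  exact exists_ne_zero_forall_algHom_mul_eq_of_surjective K hinj' (Ideal.Quotient.mkₐ K P)
    (Ideal.Quotient.mkₐ_surjective K P) (fun _ => rfl) hsep h hh

end CommutativeAlgebra

/-! ### Zariski topology, and rational maps as classes of morphisms. -/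

section ZariskiTopology

variable {K : Type*} [Field K] {X Y Z : Type*} [CoordinateRing K X] [CoordinateRing K Y]
  [CoordinateRing K Z]

theorem mem_coordRing_subtype {p : X → Prop} {f : Subtype p → K} :
    f ∈ coordRing K (Subtype p) ↔ ∃ f' ∈ coordRing K X, ∀ x, f x = f' x.1 := by
  constructor
  · rintro ⟨f', hf', rfl⟩
    exact ⟨f', hf', fun _ => rfl⟩
  · rintro ⟨f', hf', h⟩
    exact ⟨f', hf', funext fun x => (h x).symm⟩

theorem restrict_mem_coordRing {f : X → K} (hf : f ∈ coordRing K X) (p : X → Prop) :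
    (fun x : Subtype p => f x.1) ∈ coordRing K (Subtype p) :=
  mem_coordRing_subtype.2 ⟨f, hf, fun _ => rfl⟩

theorem isOpen_setOf_ne_zero {f : X → K} (hf : f ∈ coordRing K X) :
    IsOpen[zariskiTopology K X] {x | f x ≠ 0} :=
  .basic _ ⟨f, hf, rfl⟩

/-- The topology is given by a generating family; products of functions show that this family is in
fact a basis. -/
theorem exists_setOf_ne_zero_subset {V : Set X} (hV : IsOpen[zariskiTopology K X] V) {x : X}
    (hx : x ∈ V) : ∃ f ∈ coordRing K X, f x ≠ 0 ∧ ∀ y, f y ≠ 0 → y ∈ V := by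
  induction hV with
  | basic s hs =>
    obtain ⟨f, hf, rfl⟩ := hs
    exact ⟨f, hf, hx, fun _ h => h⟩
  | univ => exact ⟨1, one_mem _, by simp, fun _ _ => trivial⟩
  | inter s t _ _ hs ht =>
    obtain ⟨f, hf, hfx, hfs⟩ := hs hx.1
    obtain ⟨g, hg, hgx, hgt⟩ := ht hx.2
    exact ⟨f * g, mul_mem hf hg, mul_ne_zero hfx hgx, fun y hy =>
      ⟨hfs y (left_ne_zero_of_mul hy), hgt y (right_ne_zero_of_mul hy)⟩⟩
  | sUnion S _ hS =>
    obtain ⟨s, hs, hxs⟩ := hx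
    obtain ⟨f, hf, hfx, hfs⟩ := hS s hs hxs
    exact ⟨f, hf, hfx, fun y hy => ⟨s, hs, hfs y hy⟩⟩

theorem IsPolynomialMap.isOpen_preimage {φ : X → Y} (hφ : IsPolynomialMap K φ) {V : Set Y}
    (hV : IsOpen[zariskiTopology K Y] V) : IsOpen[zariskiTopology K X] (φ ⁻¹' V) := by
  let := zariskiTopology K X
  let := zariskiTopology K Y
  refine IsOpen.preimage (continuous_generateFrom_iff.2 ?_) hV
  rintro _ ⟨f, hf, rfl⟩
  exact isOpen_setOf_ne_zero (hφ f hf)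

theorem IsDenseOpen.inter {V W : Set X} (hV : IsDenseOpen K V) (hW : IsDenseOpen K W) :
    IsDenseOpen K (V ∩ W) := by
  let := zariskiTopology K X
  exact ⟨hV.isOpen.inter hW.isOpen, hV.dense.inter_of_isOpen_left hW.dense hV.isOpen⟩

theorem IsIrreducibleVariety.isDenseOpen (hX : IsIrreducibleVariety K X) {V : Set X}
    (hV : IsOpen[zariskiTopology K X] V) (hne : V.Nonempty) : IsDenseOpen K V := by
  let := zariskiTopology K X
  have : IrreducibleSpace X := hX
  exact ⟨hV, hV.dense hne⟩

theorem IsDenseOpen.nonempty_inter {V W : Set X} (hV : IsDenseOpen K V)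
    (hW : IsOpen[zariskiTopology K X] W) (hne : W.Nonempty) : (V ∩ W).Nonempty := by
  let := zariskiTopology K X
  simpa [Set.inter_comm] using hV.dense.inter_open_nonempty W hW hne

theorem IsIrreducibleVariety.nonempty (hX : IsIrreducibleVariety K X) : Nonempty X :=
  letI := zariskiTopology K X
  IrreducibleSpace.toNonempty (self := hX)

theorem IsDenseOpen.nonempty (hX : IsIrreducibleVariety K X) {V : Set X} (hV : IsDenseOpen K V) :
    V.Nonempty :=
  (hV.nonempty_inter (@isOpen_univ _ (zariskiTopology K X))
    (@Set.univ_nonempty _ hX.nonempty)).mono Set.inter_subset_left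

theorem IsIrreducibleVariety.eq_zero_or_eq_zero (hX : IsIrreducibleVariety K X) {f g : X → K}
    (hf : f ∈ coordRing K X) (hg : g ∈ coordRing K X) (hfg : ∀ x, f x * g x = 0) :
    (∀ x, f x = 0) ∨ ∀ x, g x = 0 := by
  by_contra! h
  obtain ⟨⟨x, hx⟩, ⟨y, hy⟩⟩ := h
  obtain ⟨z, hz, hz'⟩ := (hX.isDenseOpen (isOpen_setOf_ne_zero hf) ⟨x, hx⟩).nonempty_inter
    (isOpen_setOf_ne_zero hg) ⟨y, hy⟩
  exact mul_ne_zero hz hz' (hfg z)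

theorem IsIrreducibleVariety.isDomain (hX : IsIrreducibleVariety K X) :
    IsDomain (coordRing K X) := by
  have := hX.nonempty
  have : NoZeroDivisors (coordRing K X) := ⟨fun {f g} h =>
    (hX.eq_zero_or_eq_zero f.2 g.2 fun x => congrFun (congrArg Subtype.val h) x).imp
      (fun h => Subtype.ext (funext h)) (fun h => Subtype.ext (funext h))⟩
  exact NoZeroDivisors.to_isDomain _

/-- A function that is constant on the fibres of a dominant and generically separable morphism
to an irreducible variety is a quotient of functions on the target. -/
theorem exists_eq_div_of_forall_fiber_eq [IsAlgClosed K] (hX : IsAffineVariety K X)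
    (hXirr : IsIrreducibleVariety K X) (hZ : (coordRing K Z).FG)
    (hZev : Function.Surjective (evalAt K : Z → (coordRing K Z →ₐ[K] K)))
    {π : Z → X} (hπ : IsPolynomialMap K π)
    (hdom : ∀ f ∈ coordRing K X, (∀ z, f (π z) = 0) → ∀ x, f x = 0)
    (hsep : CharZero K ∨ ∀ z, Function.Injective (derivativeAt hπ z))
    {h : Z → K} (hh : h ∈ coordRing K Z) (hconst : ∀ z z', π z = π z' → h z = h z') :
    ∃ a ∈ coordRing K X, ∃ b ∈ coordRing K X, (∃ x, a x ≠ 0) ∧ (∀ x, a x ≠ 0 → ∃ z, π z = x) ∧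
      ∀ z, a (π z) ≠ 0 → h z = b (π z) / a (π z) := by
  have := hXirr.isDomain
  have : Algebra.FiniteType K (coordRing K X) := ⟨(Subalgebra.fg_top _).2 hX.fg⟩
  have : Algebra.FiniteType K (coordRing K Z) := ⟨(Subalgebra.fg_top _).2 hZ⟩
  let c : coordRing K X →ₐ[K] coordRing K Z := AlgHom.ofLinearMap (comorphism hπ) rfl fun _ _ => rfl
  let := c.toRingHom.toAlgebra
  have : IsScalarTower K (coordRing K X) (coordRing K Z) :=
    .of_algebraMap_eq' c.comp_algebraMap.symm
  obtain ⟨a, b, ha, hex, hab⟩ := exists_ne_zero_forall_algHom_mul_eq K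
    (B := coordRing K X) (R := coordRing K Z)
    ((injective_iff_map_eq_zero c).2 fun f hf => Subtype.ext <| funext <|
      hdom f.1 f.2 fun z => congrFun (congrArg Subtype.val hf) z)
    (hsep.imp_right fun hinj χ D hL hB => by
      obtain ⟨z, rfl⟩ := hZev χ
      have h0 : (⟨D, hL⟩ : tangentSpace K z) = 0 := hinj z <| by
        rw [map_zero]
        exact Subtype.ext (LinearMap.ext hB)
      exact congrArg Subtype.val h0)
    ⟨h, hh⟩ fun χ χ' hχ => by
      obtain ⟨z, rfl⟩ := hZev χ
      obtain ⟨z', rfl⟩ := hZev χ'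
      exact hconst z z' <| hX.bijective_evalAt.1 <| AlgHom.ext hχ
  refine ⟨a.1, a.2, b.1, b.2, ?_, fun x hx => ?_, fun z hz => ?_⟩
  · by_contra! h0
    exact ha (Subtype.ext (funext h0))
  · obtain ⟨χ, hχ⟩ := hex (evalAt K x) hx
    obtain ⟨z, rfl⟩ := hZev χ
    exact ⟨z, hX.bijective_evalAt.1 hχ⟩
  · rw [eq_div_iff hz, mul_comm]
    exact hab (evalAt K z) hz

/-- Functions on `D` are restrictions from `X`, so numerators and denominators can be taken on the
ambient `X`. -/
theorem isMorphism_iff_of_set {D : Set X} {φ : D → Y} :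
    IsMorphism K φ ↔ ∀ f ∈ coordRing K Y, ∀ x : D, ∃ p ∈ coordRing K X, ∃ q ∈ coordRing K X,
      q x ≠ 0 ∧ ∀ y : D, q y ≠ 0 → f (φ y) = p y / q y := by
  refine forall₂_congr fun f hf => forall_congr' fun x => ⟨?_, ?_⟩
  · rintro ⟨p, hp, q, hq, hx, h⟩
    obtain ⟨p', hp', hpp'⟩ := mem_coordRing_subtype.1 hp
    obtain ⟨q', hq', hqq'⟩ := mem_coordRing_subtype.1 hq
    refine ⟨p', hp', q', hq', by rwa [← hqq'], fun y hy => ?_⟩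
    rw [← hqq'] at hy ⊢
    rw [← hpp']
    exact h y hy
  · rintro ⟨p, hp, q, hq, hx, h⟩
    exact ⟨_, restrict_mem_coordRing hp _, _, restrict_mem_coordRing hq _, hx, h⟩

/-- Morphisms that agree on a dense set agree on the intersection of their domains. -/
theorem RatRep.eq_of_dense (hY : ∀ y y' : Y, (∀ f ∈ coordRing K Y, f y = f y') → y = y')
    (φ ψ : RatRep K X Y) {S : Set X}
    (hS : ∀ V, IsOpen[zariskiTopology K X] V → (φ.domain ∩ ψ.domain ∩ V).Nonempty →
      ∃ x ∈ φ.domain ∩ ψ.domain ∩ V, x ∈ S)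
    (h : ∀ x ∈ S, ∀ (h₁ : x ∈ φ.domain) (h₂ : x ∈ ψ.domain), φ.toFun ⟨x, h₁⟩ = ψ.toFun ⟨x, h₂⟩)
    {x : X} (h₁ : x ∈ φ.domain) (h₂ : x ∈ ψ.domain) : φ.toFun ⟨x, h₁⟩ = ψ.toFun ⟨x, h₂⟩ := by
  refine hY _ _ fun f hf => ?_
  obtain ⟨p, hp, q, hq, hqx, hpq⟩ := isMorphism_iff_of_set.1 φ.isMorphism f hf ⟨x, h₁⟩
  obtain ⟨r, hr, s, hs, hsx, hrs⟩ := isMorphism_iff_of_set.1 ψ.isMorphism f hf ⟨x, h₂⟩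
  rw [hpq _ hqx, hrs _ hsx]
  by_contra hne
  rw [div_eq_div_iff hqx hsx, ← Ne, ← sub_ne_zero] at hne
  -- If the fractions differ at `x`, then `q s (p s - r q)` is nonzero there; the open set it
  -- defines meets `S`, where the two maps agree.
  obtain ⟨y, ⟨⟨hy₁, hy₂⟩, hy⟩, hyS⟩ := hS _ (isOpen_setOf_ne_zero
    (mul_mem (mul_mem hq hs) (sub_mem (mul_mem hp hs) (mul_mem hr hq))))
    ⟨x, ⟨h₁, h₂⟩, mul_ne_zero (mul_ne_zero hqx hsx) hne⟩
  have hqy : q y ≠ 0 := left_ne_zero_of_mul (left_ne_zero_of_mul hy)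
  have hsy : s y ≠ 0 := right_ne_zero_of_mul (left_ne_zero_of_mul hy)
  have := congrArg f (h y hyS hy₁ hy₂)
  rw [hpq ⟨y, hy₁⟩ hqy, hrs ⟨y, hy₂⟩ hsy, div_eq_div_iff hqy hsy, ← sub_eq_zero] at this
  exact right_ne_zero_of_mul hy this

/-- Equivalence only asserts agreement on some dense open set. Regularity, with points separated by
functions, promotes it to the whole common domain. -/
theorem RatRep.eq_of_mk_eq (hY : ∀ y y' : Y, (∀ f ∈ coordRing K Y, f y = f y') → y = y')
    {φ ψ : RatRep K X Y} (h : (Quotient.mk _ φ : RatMap K X Y) = Quotient.mk _ ψ)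
    {x : X} (h₁ : x ∈ φ.domain) (h₂ : x ∈ ψ.domain) : φ.toFun ⟨x, h₁⟩ = ψ.toFun ⟨x, h₂⟩ := by
  obtain ⟨V, hV, hVe⟩ := Quotient.exact h
  refine RatRep.eq_of_dense hY φ ψ (S := V) (fun W hW hne => ?_)
    (fun y hy _ _ => (hVe y hy).2.2) h₁ h₂
  let := zariskiTopology K X
  obtain ⟨y, hy, hy'⟩ := hV.nonempty_inter
    ((φ.isDenseOpen.inter ψ.isDenseOpen).isOpen.inter hW) hne
  exact ⟨y, hy', hy⟩

theorem RatRep.mk_eq_of_eq {φ ψ : RatRep K X Y}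
    (h : ∀ x (h₁ : x ∈ φ.domain) (h₂ : x ∈ ψ.domain), φ.toFun ⟨x, h₁⟩ = ψ.toFun ⟨x, h₂⟩) :
    (Quotient.mk _ φ : RatMap K X Y) = Quotient.mk _ ψ :=
  Quotient.sound ⟨_, φ.isDenseOpen.inter ψ.isDenseOpen, fun x hx => ⟨hx.1, hx.2, h x hx.1 hx.2⟩⟩

theorem IsAffineVariety.eq_of_forall (hY : IsAffineVariety K Y) (y y' : Y)
    (h : ∀ f ∈ coordRing K Y, f y = f y') : y = y' :=
  hY.bijective_evalAt.1 (AlgHom.ext fun f => h f.1 f.2)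

theorem IsAffineVariety.subtype_eq_of_forall (hY : IsAffineVariety K Y) {p : Y → Prop}
    (y y' : Subtype p) (h : ∀ f ∈ coordRing K (Subtype p), f y = f y') : y = y' :=
  Subtype.ext (hY.eq_of_forall _ _ fun _ hf => h _ (restrict_mem_coordRing hf p))

end ZariskiTopology

/-! ### Products and principal open subsets as affine varieties. -/

section Products

variable {K : Type*} [Field K]

theorem algHom_ext_of_eq_adjoin {A C : Type*} [CommRing A] [Algebra K A] [CommRing C] [Algebra K C]
    {R : Subalgebra K A} {s : Set A} (hR : R = Algebra.adjoin K s) {χ χ' : R →ₐ[K] C}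
    (h : ∀ x ∈ s, ∀ hx : x ∈ R, χ ⟨x, hx⟩ = χ' ⟨x, hx⟩) : χ = χ' := by
  subst hR
  exact AlgHom.adjoin_ext fun x hx => h x hx _

theorem derivation_eq_zero_of_eq_adjoin {A : Type*} [CommRing A] [Algebra K A]
    {R : Subalgebra K A} {s : Set A} (hR : R = Algebra.adjoin K s) {χ D : R → K}
    (hadd : ∀ f g, D (f + g) = D f + D g) (hsmul : ∀ (c : K) f, D (c • f) = c * D f)
    (hmul : ∀ f g, D (f * g) = χ f * D g + χ g * D f) (h1 : χ 1 = 1)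
    (h : ∀ x ∈ s, ∀ hx : x ∈ R, D ⟨x, hx⟩ = 0) (f : R) : D f = 0 := by
  subst hR
  obtain ⟨f, hf⟩ := f
  induction hf using Algebra.adjoin_induction with
  | mem x hx => exact h x hx _
  | algebraMap r =>
    have hD1 : D 1 = 0 := by simpa [h1] using hmul 1 1
    have := hsmul r 1
    rw [hD1, mul_zero] at this
    rw [← this]
    exact congrArg D (Subtype.ext (Algebra.algebraMap_eq_smul_one r))
  | add x y hx hy hx' hy' => simpa [hx', hy'] using hadd ⟨x, hx⟩ ⟨y, hy⟩
  | mul x y hx hy hx' hy' => simpa [hx', hy'] using hmul ⟨x, hx⟩ ⟨y, hy⟩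

/-- Composition of functions with a map, as an algebra homomorphism. -/
def precomp (K : Type*) [Field K] {X Y : Type*} (φ : X → Y) : (Y → K) →ₐ[K] (X → K) :=
  AlgHom.pi fun x => Pi.evalAlgHom K (fun _ : Y => K) (φ x)

variable {G W T X : Type*} [CoordinateRing K G] [CoordinateRing K W] [CoordinateRing K X]

theorem fst_mem_coordRing {f : G → K} (hf : f ∈ coordRing K G) :
    (fun z : G × W => f z.1) ∈ coordRing K (G × W) :=
  Algebra.subset_adjoin (Or.inl ⟨f, hf, rfl⟩)

theorem snd_mem_coordRing {f : W → K} (hf : f ∈ coordRing K W) :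
    (fun z : G × W => f z.2) ∈ coordRing K (G × W) :=
  Algebra.subset_adjoin (Or.inr ⟨f, hf, rfl⟩)

theorem comp_prodMk_mem {R : Subalgebra K (T → K)} {g : T → G} {w : T → W}
    (hg : ∀ f ∈ coordRing K G, f ∘ g ∈ R) (hw : ∀ f ∈ coordRing K W, f ∘ w ∈ R)
    {f : G × W → K} (hf : f ∈ coordRing K (G × W)) : (fun t => f (g t, w t)) ∈ R := by
  induction hf using Algebra.adjoin_induction with
  | mem f hf =>
    rcases hf with ⟨a, ha, rfl⟩ | ⟨b, hb, rfl⟩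
    exacts [hg a ha, hw b hb]
  | algebraMap r => exact R.algebraMap_mem r
  | add _ _ _ _ hf hg => exact R.add_mem hf hg
  | mul _ _ _ _ hf hg => exact R.mul_mem hf hg

theorem IsPolynomialMap.prodMap {G' W' : Type*} [CoordinateRing K G'] [CoordinateRing K W']
    {g : G → G'} {w : W → W'} (hg : IsPolynomialMap K g) (hw : IsPolynomialMap K w) :
    IsPolynomialMap K (Prod.map g w) :=
  fun _ hf => comp_prodMk_mem (g := g ∘ Prod.fst) (w := w ∘ Prod.snd)
    (fun a ha => fst_mem_coordRing (hg a ha)) (fun b hb => snd_mem_coordRing (hw b hb)) hf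

/-- Generation by two subalgebras, rather than by sets of functions, lets finite generation be read
off from a supremum. -/
theorem coordRing_prod_eq : coordRing K (G × W) = Algebra.adjoin K
    (((coordRing K G).map (precomp K (Prod.fst : G × W → G)) : Set (G × W → K)) ∪
      (coordRing K W).map (precomp K (Prod.snd : G × W → W))) := by
  refine congrArg (Algebra.adjoin K) (congrArg₂ _ ?_ ?_) <;> ext f <;>
    exact exists_congr fun a => and_congr_right fun _ => eq_comm

theorem fg_coordRing_prod (hG : (coordRing K G).FG) (hW : (coordRing K W).FG) :
    (coordRing K (G × W)).FG := by
  rw [coordRing_prod_eq, Algebra.adjoin_union, Algebra.adjoin_eq, Algebra.adjoin_eq]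
  exact (hG.map _).sup (hW.map _)

/-- A character of the product ring restricts to a character on each factor, hence to a point of
each; the two factors generate. -/
theorem surjective_evalAt_prod (hG : Function.Surjective (evalAt K : G → (coordRing K G →ₐ[K] K)))
    (hW : Function.Surjective (evalAt K : W → (coordRing K W →ₐ[K] K))) :
    Function.Surjective (evalAt K : G × W → (coordRing K (G × W) →ₐ[K] K)) := by
  intro χ
  let c₁ : coordRing K G →ₐ[K] coordRing K (G × W) :=
    AlgHom.ofLinearMap (comorphism (φ := Prod.fst) fun _ => fst_mem_coordRing) rfl fun _ _ => rfl
  let c₂ : coordRing K W →ₐ[K] coordRing K (G × W) :=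
    AlgHom.ofLinearMap (comorphism (φ := Prod.snd) fun _ => snd_mem_coordRing) rfl fun _ _ => rfl
  obtain ⟨g, hg⟩ := hG (χ.comp c₁)
  obtain ⟨w, hw⟩ := hW (χ.comp c₂)
  refine ⟨(g, w), algHom_ext_of_eq_adjoin rfl ?_⟩
  rintro _ (⟨a, ha, rfl⟩ | ⟨b, hb, rfl⟩) _
  · exact DFunLike.congr_fun hg ⟨a, ha⟩
  · exact DFunLike.congr_fun hw ⟨b, hb⟩

/-- The principal open subset `q ≠ 0`. -/
def PrincipalOpen {K : Type*} [Field K] {S : Type*} (q : S → K) : Type _ := {s : S // q s ≠ 0}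

namespace PrincipalOpen

variable {S : Type*} [CoordinateRing K S] {q : S → K}

/-- The inclusion of a principal open subset. -/
def incl (s : PrincipalOpen q) : S := s.1

/-- The coordinate ring of a principal open subset: the localization at `q`. -/
instance coordinateRing (q : S → K) : CoordinateRing K (PrincipalOpen q) where
  functions := Algebra.adjoin K
    (((coordRing K S).map (precomp K (incl : PrincipalOpen q → S)) : Set (PrincipalOpen q → K)) ∪
      {fun s => (q s.incl)⁻¹})

theorem isPolynomialMap_incl : IsPolynomialMap K (incl : PrincipalOpen q → S) :=
  fun f hf => Algebra.subset_adjoin (Or.inl ⟨f, hf, rfl⟩)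

theorem inv_mem : (fun s : PrincipalOpen q => (q s.incl)⁻¹) ∈ coordRing K (PrincipalOpen q) :=
  Algebra.subset_adjoin (Or.inr rfl)

theorem coordRing_eq : coordRing K (PrincipalOpen q) = Algebra.adjoin K
    (((coordRing K S).map (precomp K (incl : PrincipalOpen q → S)) : Set (PrincipalOpen q → K)) ∪
      {fun s => (q s.incl)⁻¹}) :=
  rfl

theorem fg_coordRing (hS : (coordRing K S).FG) : (coordRing K (PrincipalOpen q)).FG := by
  rw [coordRing_eq, Algebra.adjoin_union, Algebra.adjoin_eq]
  exact (hS.map _).sup (Subalgebra.fg_def.2 ⟨_, Set.finite_singleton _, rfl⟩)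

/-- A subset of an affine variety has enough points if it is a principal open subset of its
closure. -/
theorem surjective_evalAt
    (hX : Function.Surjective (evalAt K : X → (coordRing K X →ₐ[K] K))) {j : S → X}
    (hj : IsPolynomialMap K j) (hj' : ∀ f ∈ coordRing K S, ∃ f' ∈ coordRing K X, f = f' ∘ j)
    {q' : X → K} (hq' : q' ∈ coordRing K X) (hq : ∀ s, q s = q' (j s))
    (hcl : ∀ x, q' x ≠ 0 → (∀ f ∈ coordRing K X, (∀ s, q s ≠ 0 → f (j s) = 0) → f x = 0) →
      ∃ s, j s = x) :
    Function.Surjective (evalAt K : PrincipalOpen q → (coordRing K (PrincipalOpen q) →ₐ[K] K)) := by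
  intro χ
  have hjP : IsPolynomialMap K (j ∘ incl : PrincipalOpen q → X) := hj.comp isPolynomialMap_incl
  let c : coordRing K X →ₐ[K] coordRing K (PrincipalOpen q) :=
    AlgHom.ofLinearMap (comorphism hjP) rfl fun _ _ => rfl
  obtain ⟨x, hx⟩ := hX (χ.comp c)
  have hxf : ∀ f (hf : f ∈ coordRing K X), χ (c ⟨f, hf⟩) = f x := fun f hf =>
    (DFunLike.congr_fun hx ⟨f, hf⟩).symm
  have hinv : q' x * χ ⟨_, inv_mem⟩ = 1 := by
    rw [← hxf q' hq', ← map_mul, ← map_one χ]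
    refine congrArg χ (Subtype.ext (funext fun s : PrincipalOpen q => ?_))
    change q' (j s.incl) * (q s.incl)⁻¹ = 1
    rw [← hq]
    exact mul_inv_cancel₀ s.2
  have hqx : q' x ≠ 0 := left_ne_zero_of_mul_eq_one hinv
  -- The character comes from a point `x` of `X` at which `q'` is invertible. Functions vanishing on
  -- the principal open set vanish at `x`, so `x` lies in its closure and `hcl` applies.
  obtain ⟨s, rfl⟩ := hcl x hqx fun f hf h0 => by
    rw [← hxf f hf, ← map_zero χ]
    exact congrArg χ (Subtype.ext (funext fun s : PrincipalOpen q => h0 s.incl s.2))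
  refine ⟨⟨s, by rwa [hq]⟩, algHom_ext_of_eq_adjoin rfl ?_⟩
  rintro _ (⟨f, hf, rfl⟩ | rfl) _
  · obtain ⟨f', hf', rfl⟩ := hj' f hf
    exact (hxf f' hf').symm
  · refine mul_left_cancel₀ hqx (Eq.trans ?_ hinv.symm)
    change q' (j s) * (q s)⁻¹ = 1
    rw [hq s]
    exact mul_inv_cancel₀ hqx

end PrincipalOpen

end Products

/-! ### Translates of rational maps and equivariance. -/

section Actions

variable {K : Type*} [Field K] {G X Y : Type*} [Group G] [CoordinateRing K G] [CoordinateRing K X]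
  [CoordinateRing K Y] [MulAction G X] [MulAction G Y]

theorem IsAlgebraicAction.isPolynomialMap_smul (h : IsAlgebraicAction K G X) (g : G) :
    IsPolynomialMap K (fun x : X => g • x) := fun f hf =>
  comp_prodMk_mem (g := fun _ => g) (w := id)
    (fun a _ => (coordRing K X).algebraMap_mem (a g)) (fun _ hb => hb) (h f hf)

/-- Translate a morphism by a group element. -/
def RatRep.translate (hX : IsAlgebraicAction K G X) (hY : IsAlgebraicAction K G Y) (g : G)
    (φ : RatRep K X Y) : RatRep K X Y where
  domain := {x | g • x ∈ φ.domain}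
  isDenseOpen := by
    let := zariskiTopology K X
    refine ⟨(hX.isPolynomialMap_smul g).isOpen_preimage φ.isDenseOpen.isOpen, ?_⟩
    rw [dense_iff_inter_open]
    rintro V hV ⟨x, hx⟩
    obtain ⟨y, hy, hy'⟩ := φ.isDenseOpen.nonempty_inter
      ((hX.isPolynomialMap_smul g⁻¹).isOpen_preimage hV) ⟨g • x, by simpa⟩
    exact ⟨g⁻¹ • y, hy', by simpa⟩
  toFun x := g⁻¹ • φ.toFun ⟨g • x.1, x.2⟩
  isMorphism := by
    refine isMorphism_iff_of_set.2 fun f hf x => ?_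
    obtain ⟨p, hp, q, hq, hqx, h⟩ := isMorphism_iff_of_set.1 φ.isMorphism _
      (hY.isPolynomialMap_smul g⁻¹ f hf) ⟨g • x.1, x.2⟩
    exact ⟨_, hX.isPolynomialMap_smul g p hp, _, hX.isPolynomialMap_smul g q hq, hqx,
      fun y hy => h ⟨g • y.1, y.2⟩ hy⟩

/-- Translation respects equivalence, so it may be computed on an equivariant representative, where
`g⁻¹ • ψ (g • x) = ψ x`. -/
theorem RatMap.IsEquivariant.mk_translate_eq (hX : IsAlgebraicAction K G X)
    (hY : IsAlgebraicAction K G Y) (hYs : IsAffineVariety K Y) {φ : RatRep K X Y}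
    (hφ : RatMap.IsEquivariant G (Quotient.mk _ φ : RatMap K X Y)) (g : G) :
    (Quotient.mk _ (φ.translate hX hY g) : RatMap K X Y) = Quotient.mk _ φ := by
  obtain ⟨ψ, hψ, hψg⟩ := hφ
  refine Eq.trans ?_ (Eq.trans (?_ : (Quotient.mk _ (ψ.translate hX hY g) : RatMap K X Y) = _) hψ)
  · exact RatRep.mk_eq_of_eq fun x h₁ h₂ => congrArg (g⁻¹ • ·)
      (RatRep.eq_of_mk_eq hYs.eq_of_forall hψ.symm _ _)
  · exact RatRep.mk_eq_of_eq fun x h₁ h₂ => inv_smul_eq_iff.2 (hψg g x h₂ h₁)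

/-- Equivariance is defined through one representative; invariance under translation extends it to
every representative. -/
theorem RatMap.IsEquivariant.toFun_smul (hX : IsAlgebraicAction K G X)
    (hY : IsAlgebraicAction K G Y) (hYs : IsAffineVariety K Y) {φ : RatRep K X Y}
    (hφ : RatMap.IsEquivariant G (Quotient.mk _ φ : RatMap K X Y)) (g : G) {x : X}
    (h : x ∈ φ.domain) (h' : g • x ∈ φ.domain) :
    φ.toFun ⟨g • x, h'⟩ = g • φ.toFun ⟨x, h⟩ :=
  inv_smul_eq_iff.1 (RatRep.eq_of_mk_eq hYs.eq_of_forall (hφ.mk_translate_eq hX hY hYs g)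
    (x := x) h' h)

end Actions

/-! ### Restriction to `A`: existence, uniqueness and injectivity. -/

section Restriction

variable {K : Type*} [Field K] {G X Y : Type*} [Group G] [CoordinateRing K X]
  [CoordinateRing K Y] [MulAction G X] [MulAction G Y] {H : Subgroup G}
  {A : SubMulAction (NormalizerQuotient H) (fixedPoints H X)}

/-- The inclusion of a subset of the fixed points into the ambient variety. -/
abbrev fixedIncl (A : SubMulAction (NormalizerQuotient H) (fixedPoints H X)) (a : A) : X :=
  (a : fixedPoints H X).1

theorem isPolynomialMap_fixedIncl : IsPolynomialMap K (fixedIncl A) :=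
  (isPolynomialMap_subtype_val K X _).comp (isPolynomialMap_subtype_val K (fixedPoints H X) _)

theorem exists_eq_comp_fixedIncl {f : A → K} (hf : f ∈ coordRing K A) :
    ∃ f' ∈ coordRing K X, f = f' ∘ fixedIncl A := by
  obtain ⟨f₁, hf₁, h₁⟩ := mem_coordRing_subtype.1 hf
  obtain ⟨f₂, hf₂, h₂⟩ := mem_coordRing_subtype.1 hf₁
  exact ⟨f₂, hf₂, funext fun a => (h₁ a).trans (h₂ _)⟩

theorem RatMap.IsRestriction.unique (hY : IsAffineVariety K Y) {F : RatMap K X Y}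
    {f f' : RatMap K A (fixedPoints H Y)}
    (h : RatMap.IsRestriction (fixedIncl A) (fun y : fixedPoints H Y => y.1) F f)
    (h' : RatMap.IsRestriction (fixedIncl A) (fun y : fixedPoints H Y => y.1) F f') : f = f' := by
  obtain ⟨Φ, φ, rfl, rfl, hφ⟩ := h
  obtain ⟨Φ', φ', hΦ', rfl, hφ'⟩ := h'
  refine RatRep.mk_eq_of_eq fun a h₁ h₂ => Subtype.ext ?_
  obtain ⟨h₃, h₄⟩ := hφ a h₁
  obtain ⟨h₅, h₆⟩ := hφ' a h₂
  exact h₄.symm.trans ((RatRep.eq_of_mk_eq hY.eq_of_forall hΦ'.symm h₃ h₅).trans h₆)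

variable [CoordinateRing K G]

theorem isOpen_setOf_smul_mem (hGX : IsAlgebraicAction K G X) (g : G) {V : Set X}
    (hV : IsOpen[zariskiTopology K X] V) :
    IsOpen[zariskiTopology K A] {a : A | g • fixedIncl A a ∈ V} :=
  ((hGX.isPolynomialMap_smul g).comp isPolynomialMap_fixedIncl).isOpen_preimage hV

/-- The translates of a dense open subset of `A` are dense if those of `U` are. -/
theorem exists_smul_mem_of_isOpen (hGX : IsAlgebraicAction K G X) {U V : Set A}
    (hdense : @DenseRange X (zariskiTopology K X) (G × U) (orbitMap U)) (hV : IsDenseOpen K V)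
    {W : Set X} (hW : IsOpen[zariskiTopology K X] W) (hne : W.Nonempty) :
    ∃ (g : G) (a : A), a ∈ V ∧ g • fixedIncl A a ∈ W := by
  let := zariskiTopology K X
  obtain ⟨⟨g, u⟩, hu⟩ := hdense.exists_mem_open hW hne
  obtain ⟨a, ha, ha'⟩ := hV.nonempty_inter (isOpen_setOf_smul_mem hGX g hW) ⟨u, hu⟩
  exact ⟨g, a, ha, ha'⟩

/-- An equivariant rational map restricts to an equivariant rational map on `A`. -/
theorem exists_isRestriction (hGX : IsAlgebraicAction K G X) (hXirr : IsIrreducibleVariety K X)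
    (hY : IsAffineVariety K Y) (hGY : IsAlgebraicAction K G Y) (hAirr : IsIrreducibleVariety K A)
    {U : Set A} (hU : IsDenseOpen K U)
    (hdense : @DenseRange X (zariskiTopology K X) (G × U) (orbitMap U))
    {F : RatMap K X Y} (hF : F.IsEquivariant G) :
    ∃ f : RatMap K A (fixedPoints H Y), f.IsEquivariant (NormalizerQuotient H) ∧
      RatMap.IsRestriction (fixedIncl A) (fun y : fixedPoints H Y => y.1) F f := by
  obtain ⟨φ, rfl⟩ := Quotient.exists_rep F
  -- The domain of `φ` may miss `A`, but it contains some `g u`. The translate by `g` represents the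
  -- same rational map and is defined at `u`.
  obtain ⟨g, u, -, hu⟩ := exists_smul_mem_of_isOpen hGX hdense hU φ.isDenseOpen.isOpen
    (φ.isDenseOpen.nonempty hXirr)
  have hmk := hF.mk_translate_eq hGX hGY hY g
  set Φ := φ.translate hGX hGY g
  rw [← hmk] at hF ⊢
  -- Taking `x' = k • x` as a separate equation allows `x' = x = a` with `k ∈ H`, which shows that
  -- the values on `A` are fixed by `H`.
  have hΦ : ∀ (k : G) (x x' : X) (h : x ∈ Φ.domain) (h' : x' ∈ Φ.domain), x' = k • x →
      Φ.toFun ⟨x', h'⟩ = k • Φ.toFun ⟨x, h⟩ := by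
    rintro k x _ h h' rfl
    exact hF.toFun_smul hGX hGY hY k h h'
  let f : RatRep K A (fixedPoints H Y) :=
    { domain := {a | fixedIncl A a ∈ Φ.domain}
      isDenseOpen := hAirr.isDenseOpen
        (isPolynomialMap_fixedIncl.isOpen_preimage Φ.isDenseOpen.isOpen) ⟨u, hu⟩
      toFun := fun a => ⟨Φ.toFun ⟨fixedIncl A a, a.2⟩, fun h =>
        (hΦ h _ _ a.2 a.2 (a.1.1.2 h).symm).symm⟩
      isMorphism := by
        refine isMorphism_iff_of_set.2 fun b hb a => ?_
        obtain ⟨b', hb', hbb'⟩ := mem_coordRing_subtype.1 hb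
        obtain ⟨p, hp, q, hq, hqx, h⟩ := isMorphism_iff_of_set.1 Φ.isMorphism b' hb'
          ⟨fixedIncl A a, a.2⟩
        exact ⟨_, isPolynomialMap_fixedIncl p hp, _, isPolynomialMap_fixedIncl q hq, hqx,
          fun y hy => (hbb' _).trans (h ⟨fixedIncl A y, y.2⟩ hy)⟩ }
  refine ⟨Quotient.mk _ f, ⟨f, rfl, fun q a h h' => ?_⟩, Φ, f, rfl, rfl, fun a h => ⟨h, rfl⟩⟩
  induction q using QuotientGroup.induction_on with | H n => ?_
  exact Subtype.ext (hΦ n _ _ h h' rfl)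

/-- By equivariance the two maps agree on all translates of a dense open subset of `A`, and these
translates are dense in `X`. -/
theorem RatMap.IsRestriction.injective (hGX : IsAlgebraicAction K G X)
    (hY : IsAffineVariety K Y) (hGY : IsAlgebraicAction K G Y) {U : Set A}
    (hdense : @DenseRange X (zariskiTopology K X) (G × U) (orbitMap U))
    {F F' : RatMap K X Y} (hF : F.IsEquivariant G) (hF' : F'.IsEquivariant G)
    {f : RatMap K A (fixedPoints H Y)}
    (h : RatMap.IsRestriction (fixedIncl A) (fun y : fixedPoints H Y => y.1) F f)
    (h' : RatMap.IsRestriction (fixedIncl A) (fun y : fixedPoints H Y => y.1) F' f) : F = F' := by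
  obtain ⟨Φ, φ, rfl, rfl, hφ⟩ := h
  obtain ⟨Φ', φ', rfl, hφφ', hφ'⟩ := h'
  have hopen := φ.isDenseOpen.inter φ'.isDenseOpen
  refine RatRep.mk_eq_of_eq fun x h₁ h₂ => RatRep.eq_of_dense hY.eq_of_forall Φ Φ'
    (S := {x | ∃ (g : G) (a : A), a ∈ φ.domain ∩ φ'.domain ∧ g • fixedIncl A a = x})
    (fun W hW hne => ?_) ?_ h₁ h₂
  · let := zariskiTopology K X
    obtain ⟨g, a, ha, ha'⟩ := exists_smul_mem_of_isOpen hGX hdense hopen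
      ((Φ.isDenseOpen.inter Φ'.isDenseOpen).isOpen.inter hW) hne
    exact ⟨_, ha', g, a, ha, rfl⟩
  · rintro _ ⟨g, a, ⟨ha, ha'⟩, rfl⟩ h₃ h₄
    obtain ⟨h₅, h₆⟩ := hφ a ha
    obtain ⟨h₇, h₈⟩ := hφ' a ha'
    rw [hF.toFun_smul hGX hGY hY g h₅ h₃, hF'.toFun_smul hGX hGY hY g h₇ h₄, h₆, h₈,
      RatRep.eq_of_mk_eq hY.subtype_eq_of_forall hφφ' ha' ha]

end Restriction

/-! ### Descent of morphisms along a dominant map, and well-definedness on orbits. -/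

section Extension

variable {K : Type*} [Field K]

/-- Near a point of its domain, finitely many coordinates of a rational map have a common
denominator. -/
theorem RatRep.exists_common_denominator {X Y : Type*} [CoordinateRing K X] [CoordinateRing K Y]
    (φ : RatRep K X Y) {x : X} (hx : x ∈ φ.domain) (t : Finset (Y → K))
    (ht : ∀ f ∈ t, f ∈ coordRing K Y) :
    ∃ s ∈ coordRing K X, s x ≠ 0 ∧ ∀ f ∈ t, ∃ p ∈ coordRing K X, ∀ y : φ.domain, s y ≠ 0 →
      f (φ.toFun y) = p y / s y := by
  classical
  induction t using Finset.induction_on with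
  | empty => exact ⟨1, one_mem _, by simp, by simp⟩
  | insert f t _ ih =>
    obtain ⟨s, hs, hsx, h⟩ := ih fun f hf => ht f (Finset.mem_insert_of_mem hf)
    obtain ⟨p, hp, q, hq, hqx, hpq⟩ :=
      isMorphism_iff_of_set.1 φ.isMorphism f (ht f (Finset.mem_insert_self _ _)) ⟨x, hx⟩
    refine ⟨s * q, mul_mem hs hq, mul_ne_zero hsx hqx, fun f' hf' => ?_⟩
    rcases Finset.mem_insert.1 hf' with rfl | hf'
    · refine ⟨p * s, mul_mem hp hs, fun y hy => ?_⟩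
      have hsy : s y ≠ 0 := left_ne_zero_of_mul hy
      have hqy : q y ≠ 0 := right_ne_zero_of_mul hy
      rw [hpq y hqy, Pi.mul_apply, Pi.mul_apply]
      field_simp
    · obtain ⟨p', hp', h'⟩ := h f' hf'
      refine ⟨p' * q, mul_mem hp' hq, fun y hy => ?_⟩
      have hsy : s y ≠ 0 := left_ne_zero_of_mul hy
      have hqy : q y ≠ 0 := right_ne_zero_of_mul hy
      rw [h' y hsy, Pi.mul_apply, Pi.mul_apply]
      field_simp

/-- It suffices to check on generators that a map is given by quotients. -/
theorem isMorphism_of_eq_adjoin {X Y : Type*} [CoordinateRing K X] [CoordinateRing K Y]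
    {t : Set (Y → K)} (ht : Algebra.adjoin K t = coordRing K Y) {W : Set X} {φ : W → Y}
    (h : ∀ f ∈ t, ∃ p ∈ coordRing K X, ∃ q ∈ coordRing K X,
      ∀ x : W, q x ≠ 0 ∧ f (φ x) = p x / q x) : IsMorphism K φ := by
  suffices ∀ f ∈ coordRing K Y, ∃ p ∈ coordRing K X, ∃ q ∈ coordRing K X,
      ∀ x : W, q x ≠ 0 ∧ f (φ x) = p x / q x by
    refine isMorphism_iff_of_set.2 fun f hf x => ?_
    obtain ⟨p, hp, q, hq, hpq⟩ := this f hf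
    exact ⟨p, hp, q, hq, (hpq x).1, fun y _ => (hpq y).2⟩
  intro f hf
  rw [← ht] at hf
  induction hf using Algebra.adjoin_induction with
  | mem f hf => exact h f hf
  | algebraMap r =>
    exact ⟨_, (coordRing K X).algebraMap_mem r, 1, one_mem _, fun x => ⟨by simp, by simp⟩⟩
  | add f g _ _ hf hg =>
    obtain ⟨p, hp, q, hq, hpq⟩ := hf
    obtain ⟨p', hp', q', hq', hpq'⟩ := hg
    refine ⟨p * q' + q * p', add_mem (mul_mem hp hq') (mul_mem hq hp'), q * q', mul_mem hq hq',
      fun x => ⟨mul_ne_zero (hpq x).1 (hpq' x).1, ?_⟩⟩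
    rw [Pi.add_apply, (hpq x).2, (hpq' x).2, div_add_div _ _ (hpq x).1 (hpq' x).1]
    rfl
  | mul f g _ _ hf hg =>
    obtain ⟨p, hp, q, hq, hpq⟩ := hf
    obtain ⟨p', hp', q', hq', hpq'⟩ := hg
    refine ⟨p * p', mul_mem hp hp', q * q', mul_mem hq hq',
      fun x => ⟨mul_ne_zero (hpq x).1 (hpq' x).1, ?_⟩⟩
    rw [Pi.mul_apply, (hpq x).2, (hpq' x).2, div_mul_div_comm]
    rfl

/-- A morphism to an affine variety that is constant on the fibres of a dominant and generically
separable morphism `π` factors through `π` over a nonempty principal open set. -/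
theorem exists_factorization [IsAlgClosed K] {X Y Z : Type*} [CoordinateRing K X]
    [CoordinateRing K Y] [CoordinateRing K Z] (hX : IsAffineVariety K X)
    (hXirr : IsIrreducibleVariety K X) (hZ : (coordRing K Z).FG)
    (hZev : Function.Surjective (evalAt K : Z → (coordRing K Z →ₐ[K] K)))
    {π : Z → X} (hπ : IsPolynomialMap K π)
    (hdom : ∀ f ∈ coordRing K X, (∀ z, f (π z) = 0) → ∀ x, f x = 0)
    (hsep : CharZero K ∨ ∀ z, Function.Injective (derivativeAt hπ z))
    {ψ : Z → Y} (hψ : IsPolynomialMap K ψ) (hconst : ∀ z z', π z = π z' → ψ z = ψ z')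
    (t : Finset (Y → K)) (ht : ∀ f ∈ t, f ∈ coordRing K Y) :
    ∃ c ∈ coordRing K X, (∃ x, c x ≠ 0) ∧ (∀ x, c x ≠ 0 → ∃ z, π z = x) ∧
      ∀ f ∈ t, ∃ p ∈ coordRing K X, ∃ q ∈ coordRing K X,
        ∀ z, c (π z) ≠ 0 → q (π z) ≠ 0 ∧ f (ψ z) = p (π z) / q (π z) := by
  classical
  induction t using Finset.induction_on with
  | empty =>
    -- The zero function is used only to obtain a nonempty principal open set inside the image of
    -- `π`.
    obtain ⟨a, ha, b, hb, hne, hex, -⟩ := exists_eq_div_of_forall_fiber_eq hX hXirr hZ hZev hπ hdom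
      hsep (zero_mem (coordRing K Z)) fun _ _ _ => rfl
    exact ⟨a, ha, hne, hex, by simp⟩
  | insert f t _ ih =>
    obtain ⟨c, hc, hne, hex, h⟩ := ih fun f hf => ht f (Finset.mem_insert_of_mem hf)
    obtain ⟨a, ha, b, hb, hane, -, hab⟩ := exists_eq_div_of_forall_fiber_eq hX hXirr hZ hZev hπ hdom
      hsep (hψ f (ht f (Finset.mem_insert_self _ _))) fun z z' h => congrArg f (hconst z z' h)
    refine ⟨c * a, mul_mem hc ha, ?_, fun x hx => hex x (left_ne_zero_of_mul hx), fun f' hf' => ?_⟩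
    · by_contra! h0
      obtain ⟨x, hx⟩ := hne
      obtain ⟨y, hy⟩ := hane
      exact (hXirr.eq_zero_or_eq_zero hc ha h0).elim (fun h => hx (h x)) (fun h => hy (h y))
    · rcases Finset.mem_insert.1 hf' with rfl | hf'
      · exact ⟨b, hb, a, ha, fun z hz => ⟨right_ne_zero_of_mul hz, hab z (right_ne_zero_of_mul hz)⟩⟩
      · obtain ⟨p, hp, q, hq, hpq⟩ := h f' hf'
        exact ⟨p, hp, q, hq, fun z hz => hpq z (left_ne_zero_of_mul hz)⟩

/-- The restriction of a morphism to a smaller dense open set. -/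
def RatRep.restrict {X Y : Type*} [CoordinateRing K X] [CoordinateRing K Y] (φ : RatRep K X Y)
    {V : Set X} (hV : IsDenseOpen K V) (hVφ : V ⊆ φ.domain) : RatRep K X Y where
  domain := V
  isDenseOpen := hV
  toFun x := φ.toFun ⟨x, hVφ x.2⟩
  isMorphism := isMorphism_iff_of_set.2 fun f hf x => by
    obtain ⟨p, hp, q, hq, hqx, h⟩ :=
      isMorphism_iff_of_set.1 φ.isMorphism f hf ⟨x, hVφ x.2⟩
    exact ⟨p, hp, q, hq, hqx, fun y hy => h ⟨y, hVφ y.2⟩ hy⟩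

variable {G X Y : Type*} [Group G] [CoordinateRing K X]
  [CoordinateRing K Y] [MulAction G X] [MulAction G Y] {H : Subgroup G}
  {A : SubMulAction (NormalizerQuotient H) (fixedPoints H X)}

/-- An equivariant morphism on `A` extends to a well-defined map on the union of the orbits. -/
theorem smul_toFun_eq_smul_toFun {U : Set A}
    (hstab : ∀ a ∈ U, stabilizer G (a : fixedPoints H X).1 = H)
    {φ : RatRep K A (fixedPoints H Y)}
    (hφ : ∀ (q : NormalizerQuotient H) (a : A) (h : a ∈ φ.domain) (h' : q • a ∈ φ.domain),
      φ.toFun ⟨q • a, h'⟩ = q • φ.toFun ⟨a, h⟩)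
    {g g' : G} {a a' : A} (ha : a ∈ U) (ha' : a' ∈ U) (h : a ∈ φ.domain) (h' : a' ∈ φ.domain)
    (heq : g • fixedIncl A a = g' • fixedIncl A a') :
    g • (φ.toFun ⟨a, h⟩).1 = g' • (φ.toFun ⟨a', h'⟩).1 := by
  have hx : fixedIncl A a' = (g'⁻¹ * g) • fixedIncl A a := by
    rw [mul_smul, heq, inv_smul_smul]
  -- This element carries `a` to `a'`, so it conjugates the stabiliser of `a` to that of `a'`; both
  -- are `H`.
  have hn : g'⁻¹ * g ∈ Subgroup.normalizer (H : Set G) := by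
    generalize g'⁻¹ * g = n at hx
    have hst := stabilizer_smul_eq_stabilizer_map_conj n (fixedIncl A a)
    rw [← hx, hstab a ha, hstab a' ha'] at hst
    rw [Subgroup.mem_normalizer_iff]
    intro k
    conv_rhs => rw [hst]
    rw [Subgroup.mem_map_equiv]
    simp [mul_assoc]
  let q : NormalizerQuotient H := QuotientGroup.mk ⟨_, hn⟩
  obtain rfl : a' = q • a := Subtype.ext (Subtype.ext hx)
  rw [hφ q a h h']
  change _ = g' • (g'⁻¹ * g) • (φ.toFun ⟨a, h⟩).1
  rw [mul_smul, smul_inv_smul]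

variable [CoordinateRing K G]

/-- A locally closed set of fixed points contains, near each point of an open subset, a principal
open subset of an affine variety. -/
theorem exists_principalOpen_closed (hX : IsAffineVariety K X) (hGX : IsAlgebraicAction K G X)
    (hA : @IsLocallyClosed (fixedPoints H X) (zariskiTopology K (fixedPoints H X)) A)
    {V : Set A} (hV : IsOpen[zariskiTopology K A] V) {a : A} (ha : a ∈ V) :
    ∃ r ∈ coordRing K X, r (fixedIncl A a) ≠ 0 ∧ (∀ b, r (fixedIncl A b) ≠ 0 → b ∈ V) ∧
      ∀ s ∈ coordRing K X, ∀ x, (s * r) x ≠ 0 →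
        (∀ f ∈ coordRing K X, (∀ b, (s * r) (fixedIncl A b) ≠ 0 → f (fixedIncl A b) = 0) →
          f x = 0) → ∃ b, fixedIncl A b = x := by
  obtain ⟨O, C, hO, hC, hOC⟩ := hA
  obtain ⟨q, hq, hqa, hqO⟩ := exists_setOf_ne_zero_subset hO (hOC.subset a.2).1
  obtain ⟨q', hq', hqq'⟩ := mem_coordRing_subtype.1 hq
  obtain ⟨r, hr, hra, hrV⟩ := exists_setOf_ne_zero_subset hV ha
  obtain ⟨r', hr', rfl⟩ := exists_eq_comp_fixedIncl hr
  -- `q'` keeps points in the open set `O` and `r'` keeps them in `V`. The further factor `s` leaves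
  -- room for the denominators of a rational map.
  refine ⟨q' * r', mul_mem hq' hr', mul_ne_zero (by rwa [← hqq']) hra,
    fun b hb => hrV b (right_ne_zero_of_mul hb), fun s _ x hx hcl => ?_⟩
  -- Being fixed by `H` is a closed condition: each `f (h x) - f x` vanishes on `A`, hence at points
  -- of the closure.
  have hfix : ∀ h : H, h • x = x := fun h => hX.eq_of_forall _ _ fun f hf => by
    have := hcl _ (sub_mem (hGX.isPolynomialMap_smul (h : G) f hf) hf) fun b _ => by
      change f ((h : G) • fixedIncl A b) - f (fixedIncl A b) = 0
      rw [show (h : G) • fixedIncl A b = fixedIncl A b from b.1.2 h, sub_self]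
    exact sub_eq_zero.1 this
  let x' : fixedPoints H X := ⟨x, hfix⟩
  have hxO : x' ∈ O := hqO x' <| by
    rw [hqq']
    exact left_ne_zero_of_mul (right_ne_zero_of_mul hx)
  have hxC : x' ∈ C := by
    by_contra hxC
    let := zariskiTopology K (fixedPoints H X)
    obtain ⟨f, hf, hfx, hfC⟩ := exists_setOf_ne_zero_subset hC.isOpen_compl hxC
    obtain ⟨f', hf', hff'⟩ := mem_coordRing_subtype.1 hf
    refine hfx ((hff' x').trans (hcl f' hf' fun b _ => ?_))
    by_contra hb
    exact hfC b.1 (by rwa [hff']) (hOC.subset b.2).2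
  exact ⟨⟨x', hOC.superset ⟨hxO, hxC⟩⟩, rfl⟩

end Extension

/-! ### Tangent vectors on principal open subsets, and extension from `A` to `X`. -/

section Surjectivity

variable {K : Type*} [Field K] {G X Y : Type*} [Group G] [CoordinateRing K G] [CoordinateRing K X]
  [CoordinateRing K Y] [MulAction G X] [MulAction G Y] {H : Subgroup G}
  {A : SubMulAction (NormalizerQuotient H) (fixedPoints H X)}

/-- A point derivation on a principal open subset vanishes if it vanishes on the functions of the
ambient set. -/
theorem PrincipalOpen.derivation_eq_zero {S : Type*} [CoordinateRing K S] {q : S → K}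
    (hq : q ∈ coordRing K S) (z : PrincipalOpen q) (D : coordRing K (PrincipalOpen q) →ₗ[K] K)
    (hD : ∀ f g, D (f * g) = f.1 z * D g + g.1 z * D f)
    (h : ∀ b (hb : b ∈ coordRing K S), D ⟨_, isPolynomialMap_incl b hb⟩ = 0) : D = 0 := by
  refine LinearMap.ext fun f => derivation_eq_zero_of_eq_adjoin coordRing_eq
    (χ := evalAt K z) (map_add D) (fun c f => map_smul D c f) hD (map_one _) ?_ f
  rintro _ (⟨b, hb, rfl⟩ | rfl) hx
  · exact h b hb
  -- The Leibniz rule applied to `q * q⁻¹ = 1` forces the derivation to vanish on `q⁻¹` once it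
  -- vanishes on `q`.
  · have hmul := hD ⟨_, isPolynomialMap_incl q hq⟩ ⟨_, hx⟩
    have h1 : (⟨_, isPolynomialMap_incl q hq⟩ * ⟨_, hx⟩ : coordRing K (PrincipalOpen q)) = 1 :=
      Subtype.ext (funext fun w => mul_inv_cancel₀ w.2)
    have hD1 : D 1 = 0 := by simpa using hD 1 1
    rw [h1, hD1, h q hq, mul_zero, add_zero] at hmul
    exact (mul_eq_zero.1 hmul.symm).resolve_left z.2

/-- A point derivation on a product vanishes if it vanishes on the functions of both factors. -/
theorem derivation_prod_eq_zero {S T : Type*} [CoordinateRing K S] [CoordinateRing K T]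
    (z : S × T) (D : coordRing K (S × T) →ₗ[K] K)
    (hD : ∀ f g, D (f * g) = f.1 z * D g + g.1 z * D f)
    (h₁ : ∀ a (ha : a ∈ coordRing K S), D ⟨_, fst_mem_coordRing ha⟩ = 0)
    (h₂ : ∀ b (hb : b ∈ coordRing K T), D ⟨_, snd_mem_coordRing hb⟩ = 0) : D = 0 := by
  refine LinearMap.ext fun f => derivation_eq_zero_of_eq_adjoin coordRing_prod_eq
    (χ := evalAt K z) (map_add D) (fun c f => map_smul D c f) hD (map_one _) ?_ f
  rintro _ (⟨a, ha, rfl⟩ | ⟨b, hb, rfl⟩) _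
  exacts [h₁ a ha, h₂ b hb]

/-- Shrinking `U` to a principal open subset creates no new tangent vectors: a derivation killing
the functions of `G × U` kills those of `G` and of `S`, and then also `q⁻¹`. -/
theorem PrincipalOpen.injective_derivativeAt {G S X : Type*} [CoordinateRing K G]
    [CoordinateRing K S] [CoordinateRing K X] {q : S → K} (hq : q ∈ coordRing K S) {U : Set S}
    {ι : PrincipalOpen q → U} (hιU : ∀ s, (ι s).1 = s.incl)
    (hι : IsPolynomialMap K (Prod.map (id : G → G) ι)) {π : G × U → X} (hπ : IsPolynomialMap K π)
    (hinj : ∀ z, Function.Injective (derivativeAt hπ z)) (z : G × PrincipalOpen q) :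
    Function.Injective (derivativeAt (hπ.comp hι) z) := by
  rw [injective_iff_map_eq_zero]
  rintro ⟨D, hD⟩ h0
  have h1 : derivativeAt hι z ⟨D, hD⟩ = 0 := by
    refine hinj _ ?_
    rw [map_zero, ← h0]
    rfl
  have h2 : ∀ f (hf : f ∈ coordRing K (G × U)), D ⟨f ∘ Prod.map id ι, hι f hf⟩ = 0 := fun f hf =>
    LinearMap.congr_fun (congrArg Subtype.val h1) ⟨f, hf⟩
  refine Subtype.ext (derivation_prod_eq_zero z D hD (fun a ha => h2 _ (fst_mem_coordRing ha))
    fun b hb => ?_)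
  let c : coordRing K (PrincipalOpen q) →ₗ[K] coordRing K (G × PrincipalOpen q) :=
    comorphism (φ := Prod.snd) fun _ => snd_mem_coordRing
  refine LinearMap.congr_fun (PrincipalOpen.derivation_eq_zero hq z.2 (D ∘ₗ c)
    (fun f g => hD (c f) (c g)) fun b hb => ?_) ⟨b, hb⟩
  rw [← h2 _ (snd_mem_coordRing (restrict_mem_coordRing hb (· ∈ U)))]
  exact congrArg D (Subtype.ext (funext fun z => congrArg b (hιU z.2).symm))

/-- Every equivariant rational map on `A` is the restriction of an equivariant rational map. -/
theorem exists_equivariant_isRestriction [IsAlgClosed K] (hG : IsLinearAlgebraicGroup K G)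
    (hX : IsAffineVariety K X) (hXirr : IsIrreducibleVariety K X) (hGX : IsAlgebraicAction K G X)
    (hY : IsAffineVariety K Y) (hGY : IsAlgebraicAction K G Y)
    (hA : @IsLocallyClosed (fixedPoints H X) (zariskiTopology K (fixedPoints H X)) A)
    (hAirr : IsIrreducibleVariety K A) {U : Set A} (hU : IsDenseOpen K U)
    (hdense : @DenseRange X (zariskiTopology K X) (G × U) (orbitMap U))
    (hstab : ∀ a ∈ U, stabilizer G (a : fixedPoints H X).1 = H)
    (hsep : CharZero K ∨ ∀ p : G × U,
      Function.Injective (derivativeAt (isPolynomialMap_orbitMap hGX U) p))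
    {f : RatMap K A (fixedPoints H Y)} (hf : f.IsEquivariant (NormalizerQuotient H)) :
    ∃ F : RatMap K X Y, F.IsEquivariant G ∧
      RatMap.IsRestriction (fixedIncl A) (fun y : fixedPoints H Y => y.1) F f := by
  classical
  obtain ⟨φ, rfl, hφ⟩ := hf
  have hUφ := hU.inter φ.isDenseOpen
  obtain ⟨a₀, ha₀⟩ := hUφ.nonempty hAirr
  obtain ⟨t, ht⟩ := hY.fg
  have htY : ∀ b ∈ t, b ∈ coordRing K Y := fun b hb => ht ▸ Algebra.subset_adjoin hb
  obtain ⟨s, hs, hsa, hsφ⟩ := φ.exists_common_denominator ha₀.2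
    (t.image fun b (y : fixedPoints H Y) => b y.1) fun b' hb' => by
      obtain ⟨b, hb, rfl⟩ := Finset.mem_image.1 hb'
      exact restrict_mem_coordRing (htY b hb) _
  obtain ⟨s', hs', rfl⟩ := exists_eq_comp_fixedIncl hs
  obtain ⟨r, hr, hra, hrV, hcl⟩ := exists_principalOpen_closed hX hGX hA hUφ.isOpen ha₀
  -- `r` makes the locus `q ≠ 0` an affine variety inside `U` and the domain of `φ`; `s'` is a
  -- common denominator for the coordinates of `φ`.
  obtain ⟨q, hqsr⟩ : ∃ q : A → K, ∀ a, q a = (s' * r) (fixedIncl A a) := ⟨_, fun _ => rfl⟩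
  have hq : q ∈ coordRing K A := by
    rw [show q = (s' * r) ∘ fixedIncl A from funext hqsr]
    exact isPolynomialMap_fixedIncl _ (mul_mem hs' hr)
  have hqne : ∀ p : PrincipalOpen q, (s' * r) (fixedIncl A p.incl) ≠ 0 := fun p => by
    rw [← hqsr]
    exact p.2
  have hqV : ∀ p : PrincipalOpen q, p.incl ∈ U ∩ φ.domain := fun p =>
    hrV _ (right_ne_zero_of_mul (hqne p))
  have hqs : ∀ p : PrincipalOpen q, s' (fixedIncl A p.incl) ≠ 0 := fun p =>
    left_ne_zero_of_mul (hqne p)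
  have hqr : ∀ p : PrincipalOpen q, r (fixedIncl A p.incl) ≠ 0 := fun p =>
    right_ne_zero_of_mul (hqne p)
  have hqa₀ : q a₀ ≠ 0 := by
    rw [hqsr]
    exact mul_ne_zero hsa hra
  have hZ : (coordRing K (G × PrincipalOpen q)).FG := fg_coordRing_prod hG.isAffineVariety.fg
    (PrincipalOpen.fg_coordRing ((hX.fg.map _).map _))
  have hZev : Function.Surjective (evalAt K : G × PrincipalOpen q → _) := surjective_evalAt_prod
    hG.isAffineVariety.bijective_evalAt.2 (PrincipalOpen.surjective_evalAt hX.bijective_evalAt.2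
      isPolynomialMap_fixedIncl (fun _ => exists_eq_comp_fixedIncl) (mul_mem hs' hr)
      hqsr fun x hx h => hcl s' hs' x hx fun f hf h0 => h f hf fun b hb => h0 b (by rwa [← hqsr]))
  obtain ⟨ι, hιU⟩ : ∃ ι : PrincipalOpen q → U, ∀ p, (ι p).1 = p.incl :=
    ⟨fun p => ⟨p.incl, (hqV p).1⟩, fun _ => rfl⟩
  have hι : IsPolynomialMap K ι := fun b hb => by
    obtain ⟨b', hb', hbb'⟩ := mem_coordRing_subtype.1 hb
    rw [show b ∘ ι = b' ∘ PrincipalOpen.incl from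
      funext fun p => (hbb' _).trans (congrArg b' (hιU p))]
    exact PrincipalOpen.isPolynomialMap_incl b' hb'
  have hι' : IsPolynomialMap K (Prod.map (id : G → G) ι) :=
    IsPolynomialMap.prodMap (fun _ h => h) hι
  have hπ : ∀ z, (orbitMap U ∘ Prod.map id ι) z = z.1 • fixedIncl A z.2.incl := fun z =>
    congrArg (fun a : A => z.1 • fixedIncl A a) (hιU z.2)
  have hsep' : CharZero K ∨ ∀ z : G × PrincipalOpen q, Function.Injective
      (derivativeAt ((isPolynomialMap_orbitMap hGX U).comp hι') z) :=
    hsep.imp_right fun h =>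
      PrincipalOpen.injective_derivativeAt hq hιU hι' (isPolynomialMap_orbitMap hGX U) h
  have hdom : ∀ b ∈ coordRing K X,
      (∀ z, b ((orbitMap U ∘ Prod.map id ι) z) = 0) → ∀ x, b x = 0 := fun b hb h0 => by
    by_contra! hne
    obtain ⟨g, a, ha, hga⟩ := exists_smul_mem_of_isOpen hGX hdense
      (hAirr.isDenseOpen (isOpen_setOf_ne_zero hq) ⟨a₀, hqa₀⟩) (isOpen_setOf_ne_zero hb) hne
    exact hga (by rw [← h0 (g, ⟨a, ha⟩), hπ]; rfl)
  let w : G × PrincipalOpen q → Y := fun z => (φ.toFun ⟨z.2.incl, (hqV z.2).2⟩).1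
  have hw : IsPolynomialMap K w := fun b hb => by
    rw [← ht] at hb
    induction hb using Algebra.adjoin_induction with
    | mem b hb =>
      obtain ⟨p, hp, hps⟩ := hsφ _ (Finset.mem_image_of_mem _ hb)
      -- The coordinate `p / s'` is rewritten as `p r / q`, since `q⁻¹` is the inverse available in
      -- the coordinate ring.
      have : b ∘ w = fun z => (p * (r ∘ fixedIncl A)) z.2.incl * (q z.2.incl)⁻¹ := by
        funext z
        have h₁ := hqs z.2
        have h₂ := hqr z.2
        refine (hps ⟨z.2.incl, (hqV z.2).2⟩ h₁).trans ?_
        simp only [hqsr, Function.comp, Pi.mul_apply]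
        field_simp
      rw [this]
      exact mul_mem (snd_mem_coordRing (PrincipalOpen.isPolynomialMap_incl _
        (mul_mem hp (isPolynomialMap_fixedIncl r hr)))) (snd_mem_coordRing PrincipalOpen.inv_mem)
    | algebraMap c => exact Subalgebra.algebraMap_mem _ c
    | add _ _ _ _ h h' => exact add_mem h h'
    | mul _ _ _ _ h h' => exact mul_mem h h'
  let ψ : G × PrincipalOpen q → Y := fun z => z.1 • w z
  have hψ : IsPolynomialMap K ψ := fun b hb =>
    comp_prodMk_mem (g := Prod.fst) (w := w) (fun _ => fst_mem_coordRing) hw (hGY b hb)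
  -- Allowing any `a` in `U ∩ φ.domain`, not only points with `q a ≠ 0`, makes this serve for
  -- constancy on fibres, for equivariance and for the restriction to `A`.
  have hconst : ∀ (z : G × PrincipalOpen q) (g : G) (a : A) (ha : a ∈ U ∩ φ.domain),
      z.1 • fixedIncl A z.2.incl = g • fixedIncl A a → ψ z = g • (φ.toFun ⟨a, ha.2⟩).1 :=
    fun z g a ha h => smul_toFun_eq_smul_toFun hstab hφ (hqV z.2).1 ha.1 _ _ h
  obtain ⟨c, hc, ⟨x₀, hx₀⟩, hcπ, hct⟩ := exists_factorization hX hXirr hZ hZev _ hdom hsep' hψ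
    (fun z z' h => hconst z z'.1 z'.2.incl (hqV z'.2) ((hπ z).symm.trans (h.trans (hπ z')))) t htY
  -- A set-theoretic section is enough, because `ψ` does not depend on the point chosen in a fibre.
  choose ζ hζ using hcπ
  have hζ' : ∀ x hx, (ζ x hx).1 • fixedIncl A (ζ x hx).2.incl = x := fun x hx =>
    (hπ _).symm.trans (hζ x hx)
  let Φ : RatRep K X Y :=
    { domain := {x | c x ≠ 0}
      isDenseOpen := hXirr.isDenseOpen (isOpen_setOf_ne_zero hc) ⟨x₀, hx₀⟩
      toFun := fun x => ψ (ζ x.1 x.2)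
      isMorphism := isMorphism_of_eq_adjoin ht fun b hb => by
        obtain ⟨p, hp, q, hq, h⟩ := hct b hb
        refine ⟨p, hp, q, hq, fun x => ?_⟩
        have := h (ζ x.1 x.2) (by rw [hζ]; exact x.2)
        rwa [hζ] at this }
  have hΦ : RatMap.IsEquivariant G (Quotient.mk _ Φ : RatMap K X Y) := by
    refine ⟨Φ, rfl, fun g x h h' => ?_⟩
    refine (hconst (ζ _ h') (g * (ζ x h).1) (ζ x h).2.incl (hqV _) ?_).trans (mul_smul ..)
    exact (hζ' _ h').trans ((congrArg (g • ·) (hζ' x h).symm).trans (mul_smul ..).symm)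
  refine ⟨_, hΦ, ?_⟩
  -- The locus `c ≠ 0` may miss `A`, so a translate of `Φ` whose domain meets `A` is used to exhibit
  -- the restriction.
  obtain ⟨g, a, ha, hga⟩ := exists_smul_mem_of_isOpen hGX hdense hUφ Φ.isDenseOpen.isOpen ⟨x₀, hx₀⟩
  have hV : IsDenseOpen K (U ∩ φ.domain ∩ {a : A | g • fixedIncl A a ∈ Φ.domain}) :=
    hUφ.inter (hAirr.isDenseOpen (isOpen_setOf_smul_mem hGX g Φ.isDenseOpen.isOpen) ⟨a, hga⟩)
  refine ⟨Φ.translate hGX hGY g, φ.restrict hV fun b hb => hb.1.2,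
    hΦ.mk_translate_eq hGX hGY hY g, RatRep.mk_eq_of_eq fun _ _ _ => rfl, fun b hb => ⟨hb.2, ?_⟩⟩
  exact inv_smul_eq_iff.2 (hconst (ζ _ hb.2) g b hb.1 (hζ' _ hb.2))

end Surjectivity

/-! ### The bijection. -/

theorem mainTheorem11 {K : Type*} [Field K] [IsAlgClosed K]
    {G : Type*} [Group G] [CoordinateRing K G] (hG : IsLinearAlgebraicGroup K G)
    {X : Type*} [CoordinateRing K X] (hX : IsAffineVariety K X) (hXirr : IsIrreducibleVariety K X)
    [MulAction G X] (hGX : IsAlgebraicAction K G X)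
    {Y : Type*} [CoordinateRing K Y] (hY : IsAffineVariety K Y) (hYirr : IsIrreducibleVariety K Y)
    [MulAction G Y] (hGY : IsAlgebraicAction K G Y)
    (H : Subgroup G) (hN : Finite (Subgroup.normalizer (H : Set G)))
    (hNK : (Nat.card (Subgroup.normalizer (H : Set G))).Coprime (ringExpChar K))
    (A : SubMulAction (NormalizerQuotient H) (fixedPoints H X))
    (hA : @IsLocallyClosed (fixedPoints H X) (zariskiTopology K (fixedPoints H X)) A)
    (hAirr : IsIrreducibleVariety K A)
    (U : Set A) (hU : IsDenseOpen K U)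
    (hdense : @DenseRange X (zariskiTopology K X) (G × U) (orbitMap U))
    (hstab : ∀ a ∈ U, stabilizer G (a : fixedPoints H X).1 = H)
    (hsep : CharZero K ∨ ∀ p : G × U,
      Function.Bijective (derivativeAt (isPolynomialMap_orbitMap hGX U) p)) :
    ∃ e : {F : RatMap K X Y // F.IsEquivariant G} ≃
        {f : RatMap K A (fixedPoints H Y) // f.IsEquivariant (NormalizerQuotient H)},
      ∀ F f, e F = f ↔
        RatMap.IsRestriction (fun a : A => (a : fixedPoints H X).1)
          (fun y : fixedPoints H Y => y.1) F.1 f.1 := by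
  -- The restriction is chosen for each `F`; its uniqueness identifies the resulting map with the
  -- restriction relation.
  choose r hr hrF using fun F : {F : RatMap K X Y // F.IsEquivariant G} =>
    exists_isRestriction hGX hXirr hY hGY hAirr hU hdense F.2
  refine ⟨Equiv.ofBijective (fun F => ⟨r F, hr F⟩) ⟨fun F F' h => ?_, fun f => ?_⟩,
    fun F f => ⟨?_, fun h => Subtype.ext ((hrF F).unique hY h)⟩⟩
  · have hrr : r F = r F' := congrArg Subtype.val h
    exact Subtype.ext (RatMap.IsRestriction.injective hGX hY hGY hdense F.2 F'.2 (hrF F)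
      (hrr ▸ hrF F'))
  · obtain ⟨F, hF, hFf⟩ := exists_equivariant_isRestriction hG hX hXirr hGX hY hGY hA hAirr hU
      hdense hstab (hsep.imp_right fun h p => (h p).1) f.2
    exact ⟨⟨F, hF⟩, Subtype.ext ((hrF ⟨F, hF⟩).unique hY hFf)⟩
  · rintro rfl
    exact hrF F
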